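/- Let $\mathbb X$ be a complex Banach space and $BUC(\mathbb R,\mathbb X)$ the Banach space of bounded uniformly continuous functions $\mathbb R\to\mathbb X$ with the sup-norm, with translation group $(S(s)g)(t)=g(t+s)$ and its generator $\mathcal D=\frac{d}{dt}$. Let $A$ be a closed linear operator on $\mathbb X$ with domain $D(A)$, let $\mathcal B$ be a bounded linear operator on $BUC(\mathbb R,\mathbb X)$ that commutes with all $S(s)$, and let $f:\mathbb R\to\mathbb X$ be (Bohr) almost periodic. Consider $$\dot u(t)=Au(t)+[\mathcal Bu](t)+f(t),\qquad t\in\mathbb R. \tag{1.1}$$ A mild solution of (1.1) is a $u\in BUC(\mathbb R,\mathbb X)$ such that for all $t\in\mathbb R$, $\int_0^t u(s)\,ds\in D(A)$ and $u(t)-u(0)=A\int_0^t u(s)\,ds+\int_0^t\big([\mathcal Bu](s)+f(s)\big)ds$. The spectrum $sp(g)$ of $g\in BUC(\mathbb R,\mathbb X)$ is the set of $\xi\in\mathbb R$ such that $\lambda\mapsto(\lambda-\mathcal D)^{-1}g$, $\mathrm{Re}\,\lambda\ne0$, has no analytic extension to any neighbourhood of $i\xi$. Let $\mathcal A$ be the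 operator of multiplication by $A$ on $BUC(\mathbb R,\mathbb X)$, with domain $\{g: g(t)\in D(A)\ \forall t,\ Ag(\cdot)\in BUC(\mathbb R,\mathbb X)\}$; let $\sigma_i(\mathcal A+\mathcal B)=\{\xi\in\mathbb R: i\xi\in\sigma(\mathcal A+\mathcal B)\}$, and for $M\subset\mathbb R$ let $e^{iM}=\{e^{i\xi}:\xi\in M\}$. Put $$\Sigma_1=\overline{e^{i\sigma_i(\mathcal A+\mathcal B)}\setminus e^{i\,sp(f)}},\qquad \Sigma_2=\overline{e^{i\,sp(f)}},\qquad \Lambda=\{\xi\in\mathbb R: e^{i\xi}\in\Sigma_1\cup\Sigma_2\},$$ and let $\Lambda_{BUC}(\mathbb X)=\{g\in BUC(\mathbb R,\mathbb X): sp(g)\subset\Lambda\}$. Theorem 20. Suppose that $\Sigma_1\cap\Sigma_2=\emptyset$ and that (1.1) has a mild solution $u\in BUC(\mathbb R,\mathbb X)$. Then there is a mild solution $w\in BUC(\mathbb R,\mathbb X)$ of (1.1) with $$e^{i\,sp(w)}\subset\overline{e^{i\,sp(f)}}.$$ Moreover, $u\in\Lambda_{BUC}(\mathbb X)$ and $w$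 can be chosen as $w=Qu$, where $Q$ is the Riesz spectral projection of the restriction $S_\Lambda(1)$ of $S(1)$ to $\Lambda_{BUC}(\mathbb X)$ that corresponds to $\Sigma_2$: the bounded projection on $\Lambda_{BUC}(\mathbb X)$ that commutes with $S_\Lambda(1)$ and is such that $S_\Lambda(1)$ has its spectrum in $\Sigma_2$ on the range of $Q$ and in $\Sigma_1$ on the range of $I-Q$. -/

import Mathlib

open scoped BoundedContinuousFunction

noncomputable section

/-- `BUC X` is the Banach space `BUC(ℝ, X)` of bounded uniformly continuous functions
`ℝ → X`, with the sup-norm. -/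
def BUC (X : Type*) [NormedAddCommGroup X] [NormedSpace ℂ X] : Submodule ℂ (ℝ →ᵇ X) where
  carrier := {g | UniformContinuous (g : ℝ → X)}
  zero_mem' := uniformContinuous_const
  add_mem' {f g} hf hg := UniformContinuous.add (f := (f : ℝ → X)) (g := (g : ℝ → X)) hf hg
  smul_mem' c g hg := UniformContinuous.const_smul (f := (g : ℝ → X)) hg c

namespace BUC

variable {X : Type*} [NormedAddCommGroup X] [NormedSpace ℂ X]

instance : CoeFun (BUC X) (fun _ => ℝ → X) := ⟨fun g => (g : ℝ →ᵇ X)⟩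

theorem ext_fun {g h : BUC X} (H : ∀ t, g t = h t) : g = h :=
  Subtype.ext (BoundedContinuousFunction.ext H)

@[simp] theorem add_fun (g h : BUC X) (t : ℝ) : (g + h) t = g t + h t := rfl
@[simp] theorem sub_fun (g h : BUC X) (t : ℝ) : (g - h) t = g t - h t := rfl
@[simp] theorem smul_fun (c : ℂ) (g : BUC X) (t : ℝ) : (c • g) t = c • g t := rfl
@[simp] theorem zero_fun (t : ℝ) : (0 : BUC X) t = 0 := rfl

/-- The translation group: `(S s g) t = g (t + s)`. -/
def S (s : ℝ) : BUC X →L[ℂ] BUC X :=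
  LinearMap.mkContinuous
    { toFun := fun g =>
        ⟨(g : ℝ →ᵇ X).compContinuous ⟨fun t => t + s, by fun_prop⟩,
          UniformContinuous.comp g.2 (uniformContinuous_id.add uniformContinuous_const)⟩
      map_add' := fun _ _ => rfl
      map_smul' := fun _ _ => rfl }
    1
    (fun g => by
      rw [one_mul]
      exact (BoundedContinuousFunction.norm_le (norm_nonneg _)).2
        (fun t => (g : ℝ →ᵇ X).norm_coe_le_norm (t + s)))

@[simp] theorem S_fun (s : ℝ) (g : BUC X) (t : ℝ) : (S s g) t = g (t + s) := rfl

end BUC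

/-- A linear operator on `BUC(ℝ, X)` is autonomous if it commutes with all translations. -/
def IsAutonomous {X : Type*} [NormedAddCommGroup X] [NormedSpace ℂ X]
    (B : BUC X →L[ℂ] BUC X) : Prop :=
  ∀ (s : ℝ) (u : BUC X), B (BUC.S s u) = BUC.S s (B u)

/-- Almost periodicity in the sense of Bohr: for each `ε > 0` the set of `ε`-almost periods is
relatively dense. -/
def IsAlmostPeriodic {X : Type*} [NormedAddCommGroup X] (g : ℝ → X) : Prop :=
  Continuous g ∧ ∀ ε > 0, ∃ l > 0, ∀ t : ℝ, ∃ τ ∈ Set.Icc t (t + l),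
    ∀ s : ℝ, ‖g (s + τ) - g s‖ ≤ ε

/-! ### Unbounded operators and their spectrum -/

/-- `λ` is in the resolvent set of `T` if `λ - T : D(T) → E` has a bounded everywhere defined
two-sided inverse. -/
def opResolventSet {E : Type*} [NormedAddCommGroup E] [NormedSpace ℂ E]
    (T : E →ₗ.[ℂ] E) : Set ℂ :=
  {z | ∃ R : E →L[ℂ] E,
    (∀ y : E, ∃ h : R y ∈ T.domain, z • R y - T ⟨R y, h⟩ = y) ∧
    (∀ x : T.domain, R (z • (x : E) - T x) = x)}

/-- The spectrum of a (possibly unbounded) operator. -/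
def opSpectrum {E : Type*} [NormedAddCommGroup E] [NormedSpace ℂ E]
    (T : E →ₗ.[ℂ] E) : Set ℂ :=
  (opResolventSet T)ᶜ

/-- `σ_i(T) = {ξ ∈ ℝ : iξ ∈ σ(T)}`. -/
def imagSpectrum {E : Type*} [NormedAddCommGroup E] [NormedSpace ℂ E]
    (T : E →ₗ.[ℂ] E) : Set ℝ :=
  {ξ | (ξ : ℂ) * Complex.I ∈ opSpectrum T}

/-- The domain of the operator of multiplication by `A` on `BUC(ℝ, X)`: all `g` such that
`g t ∈ D(A)` for all `t` and `A g(·) ∈ BUC(ℝ, X)`. -/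
def multDomain {X : Type*} [NormedAddCommGroup X] [NormedSpace ℂ X]
    (A : X →ₗ.[ℂ] X) : Submodule ℂ (BUC X) where
  carrier := {g | ∃ h : BUC X, ∀ t : ℝ, ∃ ht : g t ∈ A.domain, A ⟨g t, ht⟩ = h t}
  zero_mem' := ⟨0, fun _ => ⟨A.domain.zero_mem, A.map_zero⟩⟩
  add_mem' := by
    rintro g₁ g₂ ⟨k₁, H₁⟩ ⟨k₂, H₂⟩
    refine ⟨k₁ + k₂, fun t => ?_⟩
    obtain ⟨m₁, e₁⟩ := H₁ t
    obtain ⟨m₂, e₂⟩ := H₂ t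
    exact ⟨A.domain.add_mem m₁ m₂,
      (A.map_add ⟨g₁ t, m₁⟩ ⟨g₂ t, m₂⟩).trans (congrArg₂ (· + ·) e₁ e₂)⟩
  smul_mem' := by
    rintro c g ⟨k, H⟩
    refine ⟨c • k, fun t => ?_⟩
    obtain ⟨m, e⟩ := H t
    exact ⟨A.domain.smul_mem c m,
      (A.map_smul c ⟨g t, m⟩).trans (congrArg (c • ·) e)⟩

/-- The operator of multiplication by `A` on `BUC(ℝ, X)`: `[𝒜 g](t) = A (g t)`. -/
def multOp {X : Type*} [NormedAddCommGroup X] [NormedSpace ℂ X]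
    (A : X →ₗ.[ℂ] X) : BUC X →ₗ.[ℂ] BUC X where
  domain := multDomain A
  toFun :=
    { toFun := fun g => Classical.choose g.2
      map_add' := fun g₁ g₂ => BUC.ext_fun fun t => by
        obtain ⟨m₁, e₁⟩ := Classical.choose_spec g₁.2 t
        obtain ⟨m₂, e₂⟩ := Classical.choose_spec g₂.2 t
        obtain ⟨_, e⟩ := Classical.choose_spec (g₁ + g₂).2 t
        exact e.symm.trans ((A.map_add ⟨(g₁ : BUC X) t, m₁⟩ ⟨(g₂ : BUC X) t, m₂⟩).trans
          (congrArg₂ (· + ·) e₁ e₂))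
      map_smul' := fun c g => BUC.ext_fun fun t => by
        obtain ⟨m₁, e₁⟩ := Classical.choose_spec g.2 t
        obtain ⟨_, e⟩ := Classical.choose_spec (c • g).2 t
        exact e.symm.trans ((A.map_smul c ⟨(g : BUC X) t, m₁⟩).trans
          (congrArg (c • ·) e₁)) }

theorem multOp_apply {X : Type*} [NormedAddCommGroup X] [NormedSpace ℂ X]
    (A : X →ₗ.[ℂ] X) (g : (multOp A).domain) (t : ℝ) :
    ∃ ht : (g : BUC X) t ∈ A.domain, A ⟨(g : BUC X) t, ht⟩ = (multOp A g) t :=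
  Classical.choose_spec g.2 t

/-- The operator `𝒜 + ℬ` on `BUC(ℝ, X)`, with domain `D(𝒜)`. -/
def sumOp {X : Type*} [NormedAddCommGroup X] [NormedSpace ℂ X]
    (A : X →ₗ.[ℂ] X) (B : BUC X →L[ℂ] BUC X) : BUC X →ₗ.[ℂ] BUC X :=
  (B : BUC X →ₗ[ℂ] BUC X) +ᵥ multOp A

/-- The generator `𝒟 = d/dt` of the translation group on `BUC(ℝ, X)`: its domain consists of the
differentiable `g` with `g' ∈ BUC(ℝ, X)`. -/
def derivOp (X : Type*) [NormedAddCommGroup X] [NormedSpace ℂ X] : BUC X →ₗ.[ℂ] BUC X where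
  domain :=
    { carrier := {g | ∃ h : BUC X, ∀ t : ℝ, HasDerivAt g (h t) t}
      zero_mem' := ⟨0, fun t => hasDerivAt_const t (0 : X)⟩
      add_mem' := by
        rintro g₁ g₂ ⟨k₁, H₁⟩ ⟨k₂, H₂⟩
        exact ⟨k₁ + k₂, fun t => (H₁ t).add (H₂ t)⟩
      smul_mem' := by
        rintro c g ⟨k, H⟩
        exact ⟨c • k, fun t => (H t).const_smul c⟩ }
  toFun :=
    { toFun := fun g => g.2.choose
      map_add' := fun g₁ g₂ => BUC.ext_fun fun t =>
        ((g₁ + g₂).2.choose_spec t).unique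
          ((g₁.2.choose_spec t).add (g₂.2.choose_spec t))
      map_smul' := fun c g => BUC.ext_fun fun t =>
        ((c • g).2.choose_spec t).unique ((g.2.choose_spec t).const_smul c) }

theorem derivOp_apply {X : Type*} [NormedAddCommGroup X] [NormedSpace ℂ X]
    (g : (derivOp X).domain) (t : ℝ) :
    HasDerivAt (g : BUC X) ((derivOp X g) t) t :=
  g.2.choose_spec t

/-! ### Spectrum of a function -/

/-- `x = (z - 𝒟)⁻¹ g`, that is, `x ∈ D(𝒟)` and `z x - 𝒟 x = g`. For `Re z ≠ 0` there is exactly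
one such `x`. -/
def IsDerivResolvent {X : Type*} [NormedAddCommGroup X] [NormedSpace ℂ X]
    (z : ℂ) (g x : BUC X) : Prop :=
  ∃ h : x ∈ (derivOp X).domain, z • x - derivOp X ⟨x, h⟩ = g

/-- The (uniform) spectrum `sp(g)` of `g ∈ BUC(ℝ, X)`: the set of all real `ξ` such that the
function `z ↦ (z - 𝒟)⁻¹ g`, analytic on `ℂ ∖ iℝ` with values in `BUC(ℝ, X)`, has no analytic
extension to any neighborhood of `iξ`. -/
def sp {X : Type*} [NormedAddCommGroup X] [NormedSpace ℂ X] (g : BUC X) : Set ℝ :=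
  {ξ | ¬ ∃ (U : Set ℂ) (F : ℂ → BUC X), IsOpen U ∧ (ξ : ℂ) * Complex.I ∈ U ∧
    AnalyticOnNhd ℂ F U ∧ ∀ z ∈ U, z.re ≠ 0 → IsDerivResolvent z g (F z)}

/-- The set `{ξ ∈ ℝ : e^{iξ} ∈ M}`. -/
def expPreimage (M : Set ℂ) : Set ℝ :=
  {ξ | Complex.exp ((ξ : ℂ) * Complex.I) ∈ M}

/-- The set `e^{iM} = {e^{iξ} : ξ ∈ M}`. -/
def expSet (M : Set ℝ) : Set ℂ :=
  (fun ξ : ℝ => Complex.exp ((ξ : ℂ) * Complex.I)) '' M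

section SpectralSubspace

variable {X : Type*} [NormedAddCommGroup X] [NormedSpace ℂ X]

theorem IsDerivResolvent.add {z : ℂ} {g₁ g₂ x₁ x₂ : BUC X}
    (h₁ : IsDerivResolvent z g₁ x₁) (h₂ : IsDerivResolvent z g₂ x₂) :
    IsDerivResolvent z (g₁ + g₂) (x₁ + x₂) := by
  obtain ⟨m₁, rfl⟩ := h₁
  obtain ⟨m₂, rfl⟩ := h₂
  refine ⟨Submodule.add_mem _ m₁ m₂, ?_⟩
  have e := (derivOp X).map_add ⟨x₁, m₁⟩ ⟨x₂, m₂⟩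
  rw [AddMemClass.mk_add_mk] at e
  rw [e, smul_add]
  abel

theorem IsDerivResolvent.smul {z : ℂ} {g x : BUC X} (c : ℂ) (h : IsDerivResolvent z g x) :
    IsDerivResolvent z (c • g) (c • x) := by
  obtain ⟨m, rfl⟩ := h
  refine ⟨Submodule.smul_mem _ c m, ?_⟩
  have e := (derivOp X).map_smul c ⟨x, m⟩
  rw [SetLike.mk_smul_mk] at e
  rw [e, smul_sub, smul_comm z c]

theorem IsDerivResolvent.S {z : ℂ} {g x : BUC X} (s : ℝ) (h : IsDerivResolvent z g x) :
    IsDerivResolvent z (BUC.S s g) (BUC.S s x) := by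
  obtain ⟨m, rfl⟩ := h
  have key : ∀ t : ℝ, HasDerivAt (BUC.S s x) ((BUC.S s (derivOp X ⟨x, m⟩)) t) t := fun t =>
    (derivOp_apply ⟨x, m⟩ (t + s)).comp_add_const t s
  refine ⟨⟨_, key⟩, BUC.ext_fun fun t => ?_⟩
  have e := (derivOp_apply (X := X) ⟨BUC.S s x, ⟨_, key⟩⟩ t).unique (key t)
  rw [BUC.sub_fun, e]
  rfl

/-- The spectral subspace `Λ_BUC(X) = {g ∈ BUC(ℝ, X) : sp(g) ⊂ Λ}`. -/
def spectralSubspace (X : Type*) [NormedAddCommGroup X] [NormedSpace ℂ X] (L : Set ℝ) :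
    Submodule ℂ (BUC X) where
  carrier := {g | sp g ⊆ L}
  zero_mem' := fun ξ hξ => by
    refine (hξ ⟨Set.univ, 0, isOpen_univ, Set.mem_univ _, analyticOnNhd_const, ?_⟩).elim
    intro z _ _
    refine ⟨Submodule.zero_mem _, ?_⟩
    have e : derivOp X ⟨(0 : ℂ → BUC X) z, Submodule.zero_mem _⟩ = 0 := (derivOp X).map_zero
    rw [e]
    simp
  add_mem' := by
    intro g₁ g₂ h₁ h₂ ξ hξ
    by_contra hL
    have n₁ : ξ ∉ sp g₁ := fun h => hL (h₁ h)
    have n₂ : ξ ∉ sp g₂ := fun h => hL (h₂ h)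
    obtain ⟨U₁, F₁, o₁, i₁, a₁, r₁⟩ := not_not.1 n₁
    obtain ⟨U₂, F₂, o₂, i₂, a₂, r₂⟩ := not_not.1 n₂
    exact hξ ⟨U₁ ∩ U₂, F₁ + F₂, o₁.inter o₂, ⟨i₁, i₂⟩,
      (a₁.mono Set.inter_subset_left).add (a₂.mono Set.inter_subset_right),
      fun z hz h0 => (r₁ z hz.1 h0).add (r₂ z hz.2 h0)⟩
  smul_mem' := by
    intro c g h ξ hξ
    by_contra hL
    have n : ξ ∉ sp g := fun h' => hL (h h')
    obtain ⟨U, F, o, i, a, r⟩ := not_not.1 n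
    exact hξ ⟨U, c • F, o, i, fun z hz => (a z hz).const_smul,
      fun z hz h0 => (r z hz h0).smul c⟩

theorem S_mem_spectralSubspace {L : Set ℝ} (s : ℝ) {g : BUC X}
    (hg : g ∈ spectralSubspace X L) : BUC.S s g ∈ spectralSubspace X L := by
  intro ξ hξ
  by_contra hL
  have n : ξ ∉ sp g := fun h' => hL (hg h')
  obtain ⟨U, F, o, i, a, r⟩ := not_not.1 n
  exact hξ ⟨U, BUC.S s ∘ F, o, i,
    fun z hz => ((BUC.S s).analyticAt (F z)).comp (a z hz), fun z hz h0 => (r z hz h0).S s⟩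

/-- The restriction `S_Λ(s)` of the translation `S(s)` to `Λ_BUC(X)`. -/
def restrictedS (X : Type*) [NormedAddCommGroup X] [NormedSpace ℂ X] (L : Set ℝ) (s : ℝ) :
    spectralSubspace X L →L[ℂ] spectralSubspace X L :=
  ((BUC.S s).comp (spectralSubspace X L).subtypeL).codRestrict (spectralSubspace X L)
    (fun g => S_mem_spectralSubspace s g.2)

end SpectralSubspace

/-- The bounded operator `T` commuting with the bounded projection `P` has no spectrum outside `M`
on the range of `P`: for `z ∉ M` the operator `z - T` restricted to the range of `P` is invertible,
with bounded inverse the restriction of `R`. -/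
def SpectrumOnRangeSubset {E : Type*} [NormedAddCommGroup E] [NormedSpace ℂ E]
    (T P : E →L[ℂ] E) (M : Set ℂ) : Prop :=
  ∀ z ∉ M, ∃ R : E →L[ℂ] E, ∀ x : E, P x = x →
    P (R x) = R x ∧ z • R x - T (R x) = x ∧ R (z • x - T x) = x

/-- `Q` is the Riesz (spectral) projection of the bounded operator `T` with respect to the part
`M₂` of the decomposition of the spectrum of `T` into disjoint closed parts `M₁`, `M₂`: it is a
bounded projection which commutes with `T`, the restriction of `T` to the range of `Q` has spectrum
in `M₂`, and the restriction of `T` to the range of `1 - Q` has spectrum in `M₁`. These properties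
determine `Q`. -/
structure IsRieszProjection {E : Type*} [NormedAddCommGroup E] [NormedSpace ℂ E]
    (T : E →L[ℂ] E) (M₁ M₂ : Set ℂ) (Q : E →L[ℂ] E) : Prop where
  idem : ∀ x, Q (Q x) = Q x
  comm : ∀ x, Q (T x) = T (Q x)
  range_spec : SpectrumOnRangeSubset T Q M₂
  ker_spec : SpectrumOnRangeSubset T (ContinuousLinearMap.id ℂ E - Q) M₁

/-- Mild solutions `u ∈ BUC(ℝ, X)` of `u'(t) = A u(t) + [ℬu](t) + f(t)`. -/
def IsMildSolution {X : Type*} [NormedAddCommGroup X] [NormedSpace ℂ X]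
    (A : X →ₗ.[ℂ] X) (B : BUC X →L[ℂ] BUC X) (f u : BUC X) : Prop :=
  ∀ t : ℝ, ∃ h : (∫ s in (0 : ℝ)..t, u s) ∈ A.domain,
    u t - u 0 = A ⟨∫ s in (0 : ℝ)..t, u s, h⟩ + ∫ s in (0 : ℝ)..t, ((B u) s + f s)

end

/-! The projection is built as a function of `S 1`. Since `Sig₁` and `Sig₂` are disjoint and closed,
there is a smooth `φ` on `ℂ` that is 0 near `Sig₁` and 1 near `Sig₂`. Its restriction to the unit
circle has an absolutely convergent Fourier series, so `T = ∑ aₙ S(n)` is a bounded operator with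
symbol `φ(e^{iξ})`. The solution sought is `w = T u`, and `T` restricted to the spectral subspace is
the Riesz projection.

Three facts carry the argument.

Locality of the calculus (`HasSymbol.apply_eq_zero`): an operator whose symbol vanishes on an open
set containing `sp g` annihilates `g`. The Abel means of `g` at the frequency `ξ` are differences of
the resolvent of `𝒟` at `±ε + iξ`, so they tend to 0 locally uniformly off `sp g`. A band-limited
smoothing of `T g` is the limit of integrals of the Abel means against the symbol, hence it is 0,
and an approximate identity removes the smoothing. Consequently `T f = f`, and `T` is idempotent on
the spectral subspace. Inverting `z - w` smoothly near `Sig₂` or `Sig₁` gives the spectra on the two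
ranges. A similar inversion shows that `sp (T u)` avoids frequencies near which the symbol vanishes
(`HasSymbol.notMem_sp`).

Spectrum of a mild solution (`IsMildSolution.sp_subset`): `(z - 𝒜 - ℬ)(z - 𝒟)⁻¹u = u + (z - 𝒟)⁻¹f`.
Where `iξ` is in the resolvent set of `𝒜 + ℬ` and `ξ ∉ sp f`, this can be solved analytically for
`(z - 𝒟)⁻¹u`, whence `sp u ⊆ σ_i(𝒜 + ℬ) ∪ sp f`.

Invariance (`HasSymbol.mem_mildSubmodule`): the pairs `(u, f)` with `u` a mild solution for `f` form
a closed translation-invariant subspace, so `(T u, T f) = (T u, f)` is again such a pair. -/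

open Filter Topology MeasureTheory Set

noncomputable section

/-! ### Translations and convolutions on `BUC` -/

namespace BUC

variable {X : Type*} [NormedAddCommGroup X] [NormedSpace ℂ X]

theorem isClosed_coe : IsClosed (BUC X : Set (ℝ →ᵇ X)) := by
  refine isClosed_of_closure_subset fun g hg => ?_
  obtain ⟨u, hu, hlim⟩ := mem_closure_iff_seq_limit.1 hg
  exact (BoundedContinuousFunction.tendsto_iff_tendstoUniformly.1 hlim).uniformContinuous
    (Frequently.of_forall hu)

instance [CompleteSpace X] : CompleteSpace (BUC X) :=
  (isClosed_coe (X := X)).completeSpace_coe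

theorem uniformContinuous (g : BUC X) : UniformContinuous (g : ℝ → X) := g.2

theorem continuous_fun (g : BUC X) : Continuous (g : ℝ → X) := g.2.continuous

theorem norm_fun_le (g : BUC X) (t : ℝ) : ‖g t‖ ≤ ‖g‖ := (g : ℝ →ᵇ X).norm_coe_le_norm t

theorem norm_le_of_forall {g : BUC X} {C : ℝ} (hC : 0 ≤ C) (h : ∀ t, ‖g t‖ ≤ C) : ‖g‖ ≤ C :=
  (BoundedContinuousFunction.norm_le hC).2 h

/-- Evaluation at `t`. -/
def evalCLM (t : ℝ) : BUC X →L[ℂ] X :=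
  LinearMap.mkContinuous
    { toFun := fun g => g t
      map_add' := fun _ _ => rfl
      map_smul' := fun _ _ => rfl } 1 (fun g => by simpa using norm_fun_le g t)

@[simp] theorem evalCLM_apply (t : ℝ) (g : BUC X) : evalCLM t g = g t := rfl

protected theorem sub_smul (a b : ℂ) (g : BUC X) : (a - b) • g = a • g - b • g :=
  _root_.sub_smul a b g

protected theorem neg_smul (a : ℂ) (g : BUC X) : -a • g = -(a • g) := _root_.neg_smul a g

protected theorem integral_smul_const [CompleteSpace X] (f : ℝ → ℂ) (g : BUC X) :
    ∫ x, f x • g = (∫ x, f x) • g := _root_.integral_smul_const f g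

theorem S_S (a b : ℝ) (g : BUC X) : S a (S b g) = S (a + b) g :=
  ext_fun fun t => by simp [add_assoc]

theorem S_comm (a b : ℝ) (g : BUC X) : S a (S b g) = S b (S a g) := by
  rw [S_S, S_S, add_comm]

@[simp] theorem S_zero (g : BUC X) : S 0 g = g := ext_fun fun t => by simp

theorem norm_S_le (a : ℝ) (g : BUC X) : ‖S a g‖ ≤ ‖g‖ :=
  norm_le_of_forall (norm_nonneg _) fun _ => norm_fun_le g _

theorem continuous_S (g : BUC X) : Continuous fun s => S s g := by
  refine Metric.continuous_iff.2 fun b ε hε => ?_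
  obtain ⟨δ, hδ, h⟩ := Metric.uniformContinuous_iff.1 (uniformContinuous g) (ε / 2) (half_pos hε)
  refine ⟨δ, hδ, fun a ha => ?_⟩
  rw [dist_eq_norm]
  refine (norm_le_of_forall (half_pos hε).le fun t => ?_).trans_lt (half_lt_self hε)
  have := h (a := t + a) (b := t + b) (by simpa using ha)
  rw [dist_eq_norm] at this
  exact this.le

theorem integrable_smul_S {k : ℝ → ℂ} (hk : Integrable k) (g : BUC X) :
    Integrable fun s => k s • S s g := by
  refine (hk.norm.mul_const ‖g‖).mono'
    (hk.aestronglyMeasurable.smul (continuous_S g).aestronglyMeasurable) (.of_forall fun s => ?_)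
  rw [norm_smul]
  exact mul_le_mul_of_nonneg_left (norm_S_le s g) (norm_nonneg _)

/-- The operator `g ↦ ∫ k(s) S(s) g ds`. -/
def conv (k : ℝ → ℂ) (hk : Integrable k) : BUC X →L[ℂ] BUC X :=
  LinearMap.mkContinuous
    { toFun := fun g => ∫ s, k s • S s g
      map_add' := fun g h => by
        simp only [map_add, smul_add]
        exact integral_add (integrable_smul_S hk g) (integrable_smul_S hk h)
      map_smul' := fun c g => by
        simp only [map_smul, RingHom.id_apply, smul_comm _ c]
        exact integral_smul c _ }
    (∫ s, ‖k s‖) (fun g => by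
      rw [← integral_mul_const]
      refine norm_integral_le_of_norm_le (hk.norm.mul_const _) (.of_forall fun s => ?_)
      rw [norm_smul]
      exact mul_le_mul_of_nonneg_left (norm_S_le s g) (norm_nonneg _))

theorem conv_def {k : ℝ → ℂ} (hk : Integrable k) (g : BUC X) :
    conv k hk g = ∫ s, k s • S s g := rfl

variable [CompleteSpace X]

theorem conv_fun {k : ℝ → ℂ} (hk : Integrable k) (g : BUC X) (t : ℝ) :
    conv k hk g t = ∫ s, k s • g (t + s) := by
  rw [conv_def, ← evalCLM_apply, ← ContinuousLinearMap.integral_comp_comm _ (integrable_smul_S hk g)]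
  rfl

/-- An operator commuting with translations commutes with convolutions. -/
theorem map_conv {k : ℝ → ℂ} (hk : Integrable k) {T : BUC X →L[ℂ] BUC X} (hT : IsAutonomous T)
    (g : BUC X) : T (conv k hk g) = conv k hk (T g) := by
  rw [conv_def, conv_def, ← ContinuousLinearMap.integral_comp_comm _ (integrable_smul_S hk g)]
  simp only [map_smul, hT _ g]

theorem isAutonomous_conv {k : ℝ → ℂ} (hk : Integrable k) :
    IsAutonomous (conv k hk : BUC X →L[ℂ] BUC X) := fun s g =>
  (map_conv hk (T := S s) (fun a u => S_comm s a u) g).symm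

end BUC

theorem isAutonomous_S {X : Type*} [NormedAddCommGroup X] [NormedSpace ℂ X] (a : ℝ) :
    IsAutonomous (BUC.S a : BUC X →L[ℂ] BUC X) := fun s u => BUC.S_comm a s u

/-! ### The generator of the translation group -/

section Generator

variable {X : Type*} [NormedAddCommGroup X] [NormedSpace ℂ X]

theorem isDerivResolvent_iff {z : ℂ} {g x : BUC X} :
    IsDerivResolvent z g x ↔ ∀ t, HasDerivAt x ((z • x - g) t) t := by
  constructor
  · rintro ⟨h, rfl⟩ t
    have := derivOp_apply ⟨x, h⟩ t
    rwa [sub_sub_cancel]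
  · intro h
    have hx : x ∈ (derivOp X).domain := ⟨_, h⟩
    refine ⟨hx, BUC.ext_fun fun t => ?_⟩
    have := (derivOp_apply ⟨x, hx⟩ t).unique (h t)
    rw [BUC.sub_fun, this]
    simp

/-- Pointwise differentiability with derivative in `BUC` amounts to differentiability of the
orbit. -/
theorem hasDerivAt_S_iff {x y : BUC X} :
    HasDerivAt (fun s => BUC.S s x) y 0 ↔ ∀ t, HasDerivAt x (y t) t := by
  constructor
  · intro h t
    have h1 := ((BUC.evalCLM t).restrictScalars ℝ).hasFDerivAt.comp_hasDerivAt (0 : ℝ) h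
    have h2 : HasDerivAt (fun s : ℝ => x (t + s)) (y t) 0 := h1
    have h3 := h2.scomp_of_eq t ((hasDerivAt_id t).sub_const t) (by simp)
    simpa [Function.comp_def] using h3
  · intro h
    rw [hasDerivAt_iff_isLittleO, Asymptotics.isLittleO_iff]
    intro ε hε
    obtain ⟨δ, hδ, hy⟩ := Metric.uniformContinuous_iff.1 (BUC.uniformContinuous y) ε hε
    filter_upwards [Metric.ball_mem_nhds (0 : ℝ) hδ] with s hs
    refine BUC.norm_le_of_forall (by positivity) fun t => ?_
    -- Mean value inequality for `r ↦ x r - r • y t`. Uniform continuity of the derivative `y`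
    -- bounds it by an `ε` independent of `t`, which gives convergence in sup-norm.
    have key : ‖(x (t + s) - (t + s) • y t) - (x t - t • y t)‖ ≤ ε * ‖(t + s) - t‖ := by
      refine (convex_uIcc t (t + s)).norm_image_sub_le_of_norm_hasDerivWithin_le
        (f := fun r => x r - r • y t) (f' := fun r => y r - y t)
        (fun r _ => ?_) (fun r hr => ?_) left_mem_uIcc right_mem_uIcc
      · have := ((h r).sub ((hasDerivAt_id r).smul_const (y t))).hasDerivWithinAt (s := uIcc t (t + s))
        rw [one_smul] at this
        exact this
      · rw [← dist_eq_norm]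
        refine (hy ?_).le
        have := abs_sub_left_of_mem_uIcc hr
        rw [Real.dist_eq]
        refine this.trans_lt ?_
        simpa using hs
    have e : (x (t + s) - (t + s) • y t) - (x t - t • y t) =
        (BUC.S s x - BUC.S 0 x - (s - 0) • y) t := by
      rw [BUC.sub_fun, BUC.sub_fun]
      change _ = x (t + s) - x (t + 0) - (s - 0) • y t
      rw [add_smul, add_zero, sub_zero]; abel
    rw [← e]
    simpa using key

/-- `T` carries the orbit of `x` to the orbit of `T x`, and a bounded operator preserves norm
differentiability of orbits. Pointwise differentiability alone would not suffice, since `T` need not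
act pointwise. -/
theorem IsAutonomous.isDerivResolvent {T : BUC X →L[ℂ] BUC X} (hT : IsAutonomous T) {z : ℂ}
    {g x : BUC X} (h : IsDerivResolvent z g x) : IsDerivResolvent z (T g) (T x) := by
  rw [isDerivResolvent_iff, ← hasDerivAt_S_iff] at h ⊢
  have := (T.restrictScalars ℝ).hasFDerivAt.comp_hasDerivAt (0 : ℝ) h
  simp only [Function.comp_def, ContinuousLinearMap.coe_restrictScalars', map_sub, map_smul,
    hT _ x] at this
  exact this

theorem IsAutonomous.sp_subset {T : BUC X →L[ℂ] BUC X} (hT : IsAutonomous T) (g : BUC X) :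
    sp (T g) ⊆ sp g := by
  rintro ξ hξ ⟨U, F, hU, hm, hF, hr⟩
  exact hξ ⟨U, T ∘ F, hU, hm, fun z hz => (T.analyticAt (F z)).comp (hF z hz),
    fun z hz h0 => hT.isDerivResolvent (hr z hz h0)⟩

theorem IsAutonomous.mem_spectralSubspace {T : BUC X →L[ℂ] BUC X} (hT : IsAutonomous T)
    {L : Set ℝ} {g : BUC X} (hg : g ∈ spectralSubspace X L) : T g ∈ spectralSubspace X L :=
  (hT.sp_subset g).trans hg

theorem IsAutonomous.comp {T T' : BUC X →L[ℂ] BUC X} (hT : IsAutonomous T)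
    (hT' : IsAutonomous T') : IsAutonomous (T.comp T') := fun s u => by
  simp only [ContinuousLinearMap.comp_apply, hT' s, hT s]

end Generator

/-! ### The resolvent of the generator as a convolution -/

section Resolvent

open Complex (exp)

variable {X : Type*} [NormedAddCommGroup X] [NormedSpace ℂ X]

theorem integrableOn_exp_smul {A : Set ℝ} {z : ℂ}
    (h : IntegrableOn (fun s : ℝ => exp (-z * s)) A) (g : BUC X) :
    IntegrableOn (fun s : ℝ => exp (-z * s) • g s) A := by
  refine (h.norm.mul_const ‖g‖).mono'
    (h.aestronglyMeasurable.smul (BUC.continuous_fun g).aestronglyMeasurable)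
    (.of_forall fun s => ?_)
  rw [norm_smul]
  exact mul_le_mul_of_nonneg_left (BUC.norm_fun_le g s) (norm_nonneg _)

/-- The kernel of `(z - 𝒟)⁻¹` for `Re z ≠ 0`. -/
def resolventKernel (z : ℂ) : ℝ → ℂ :=
  if 0 < z.re then (Ioi 0).indicator fun s : ℝ => exp (-z * s)
  else -(Iic 0).indicator fun s : ℝ => exp (-z * s)

theorem integrable_resolventKernel {z : ℂ} (hz : z.re ≠ 0) : Integrable (resolventKernel z) := by
  unfold resolventKernel
  split_ifs with h
  · exact (integrable_indicator_iff measurableSet_Ioi).2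
      (integrableOn_exp_mul_complex_Ioi (by simpa using h) 0)
  · exact ((integrable_indicator_iff measurableSet_Iic).2
      (integrableOn_exp_mul_complex_Iic (by simpa using lt_of_le_of_ne (not_lt.1 h) hz) 0)).neg

theorem hasDerivAt_exp_smul_S {z : ℂ} {g x : BUC X} (h : IsDerivResolvent z g x) (s : ℝ) :
    HasDerivAt (fun s : ℝ => -(exp (-z * s) • BUC.S s x)) (exp (-z * s) • BUC.S s g) s := by
  rw [isDerivResolvent_iff, ← hasDerivAt_S_iff] at h
  have h1 : HasDerivAt (fun r => BUC.S r x) (BUC.S s (z • x - g)) s := by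
    have h2 := ((BUC.S s : BUC X →L[ℂ] BUC X).restrictScalars ℝ).hasFDerivAt.comp_hasDerivAt
      (0 : ℝ) h
    have h3 := h2.scomp_of_eq s ((hasDerivAt_id s).sub_const s) (by simp)
    simpa [Function.comp_def, BUC.S_S] using h3
  have h4 : HasDerivAt (fun r : ℝ => exp (-z * r)) (exp (-z * s) * -z) s := by
    have := (((hasDerivAt_id (s : ℂ)).const_mul (-z)).cexp).comp_ofReal
    simpa using this
  have h5 := (h4.smul h1).neg
  convert! h5 using 1
  rw [map_sub, map_smul, smul_sub, smul_smul]
  module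

theorem norm_exp_neg_mul (z : ℂ) (s : ℝ) : ‖exp (-z * s)‖ = Real.exp (-z.re * s) := by
  rw [Complex.norm_exp]; simp

variable [CompleteSpace X]

/-- Uniqueness of the resolvent: `e^{-zs} S(s) g` is the derivative of `-e^{-zs} S(s) x`, which
decays on the half-line chosen by the sign of `Re z`, so the integral reduces to its boundary value
at 0. -/
theorem IsDerivResolvent.eq_conv {z : ℂ} (hz : z.re ≠ 0) {g x : BUC X}
    (h : IsDerivResolvent z g x) :
    x = BUC.conv (resolventKernel z) (integrable_resolventKernel hz) g := by
  have hint := BUC.integrable_smul_S (integrable_resolventKernel hz) g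
  have hlim : ∀ l : Filter ℝ, Tendsto (fun s : ℝ => Real.exp (-z.re * s)) l (𝓝 0) →
      Tendsto (fun s : ℝ => -(exp (-z * s) • BUC.S s x)) l (𝓝 0) := by
    intro l hl
    have h0 : Tendsto (fun s : ℝ => Real.exp (-z.re * s) * ‖x‖) l (𝓝 0) := by
      simpa using hl.mul_const ‖x‖
    refine squeeze_zero_norm (fun s => ?_) h0
    rw [norm_neg, norm_smul, norm_exp_neg_mul]
    exact mul_le_mul_of_nonneg_left (BUC.norm_S_le s x) (Real.exp_pos _).le
  rw [BUC.conv_def]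
  by_cases hp : 0 < z.re
  · have e : (fun s => resolventKernel z s • BUC.S s g) =
        (Ioi 0).indicator fun s : ℝ => exp (-z * s) • BUC.S s g := by
      ext1 s
      rw [resolventKernel, if_pos hp, indicator_smul_apply_left]
    rw [e] at hint ⊢
    rw [integral_indicator measurableSet_Ioi,
      integral_Ioi_of_hasDerivAt_of_tendsto' (fun s _ => hasDerivAt_exp_smul_S h s)
        ((integrable_indicator_iff measurableSet_Ioi).1 hint) (hlim atTop ?_)]
    · simp
    · refine Real.tendsto_exp_atBot.comp ?_
      exact tendsto_id.const_mul_atTop_of_neg (by simpa using hp)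
  · have hn : z.re < 0 := lt_of_le_of_ne (not_lt.1 hp) hz
    have e : (fun s => resolventKernel z s • BUC.S s g) =
        -(Iic 0).indicator fun s : ℝ => exp (-z * s) • BUC.S s g := by
      ext1 s
      rw [resolventKernel, if_neg hp, Pi.neg_apply, Pi.neg_apply, BUC.neg_smul,
        indicator_smul_apply_left]
    rw [e] at hint ⊢
    rw [integral_neg', integral_indicator measurableSet_Iic,
      integral_Iic_of_hasDerivAt_of_tendsto' (fun s _ => hasDerivAt_exp_smul_S h s)
        ((integrable_indicator_iff measurableSet_Iic).1 (by simpa using hint.neg)) (hlim atBot ?_)]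
    · simp
    · refine Real.tendsto_exp_atBot.comp ?_
      exact tendsto_id.const_mul_atBot (by simpa using hn)

/-- The function `t ↦ e^{zt} (c - ∫_0^t e^{-zr} g(r) dr)` solves `x' = z x - g`. -/
theorem hasDerivAt_exp_mul_sub_integral (z : ℂ) (c : X) (g : BUC X) (t : ℝ) :
    HasDerivAt (fun t : ℝ => exp (z * t) • (c - ∫ r in (0 : ℝ)..t, exp (-z * r) • g r))
      (z • (exp (z * t) • (c - ∫ r in (0 : ℝ)..t, exp (-z * r) • g r)) - g t) t := by
  have hc : Continuous fun r : ℝ => exp (-z * r) • g r :=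
    (by fun_prop : Continuous fun r : ℝ => exp (-z * r)).smul (BUC.continuous_fun g)
  have h1 := (intervalIntegral.integral_hasDerivAt_right (hc.intervalIntegrable 0 t)
    (hc.stronglyMeasurableAtFilter _ _) hc.continuousAt).const_sub c
  have h4 : HasDerivAt (fun r : ℝ => exp (z * r)) (exp (z * t) * z) t := by
    have := (((hasDerivAt_id (t : ℂ)).const_mul z).cexp).comp_ofReal
    simpa using this
  convert! h4.smul h1 using 1
  rw [smul_neg, smul_smul (exp (z * t)), ← Complex.exp_add]
  simp only [neg_mul, add_neg_cancel, Complex.exp_zero, one_smul]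
  rw [smul_smul, mul_comm z, sub_eq_neg_add]

theorem conv_fun_eq_integral {k : ℝ → ℂ} (hk : Integrable k) (g : BUC X) (t : ℝ) :
    BUC.conv k hk g t = ∫ r, k (r - t) • g r := by
  rw [BUC.conv_fun, ← integral_add_left_eq_self (fun r => k (r - t) • g r) t]
  simp only [add_sub_cancel_left]

theorem isDerivResolvent_conv {z : ℂ} (hz : z.re ≠ 0) (g : BUC X) :
    IsDerivResolvent z g (BUC.conv (resolventKernel z) (integrable_resolventKernel hz) g) := by
  have hexp : ∀ r t : ℝ, exp (-z * (r - t : ℝ)) = exp (z * t) * exp (-z * r) := fun r t => by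
    rw [← Complex.exp_add]; push_cast; ring_nf
  have hc : Continuous fun r : ℝ => exp (-z * r) • g r :=
    (by fun_prop : Continuous fun r : ℝ => exp (-z * r)).smul (BUC.continuous_fun g)
  -- The constant `c` is the value at 0 of the bounded solution of `x' = z x - g`: the integral of
  -- `e^{-zr} g(r)` over the positive half-line, or minus the one over the negative half-line.
  obtain ⟨c, hx⟩ : ∃ c : X, ∀ t, BUC.conv (resolventKernel z) (integrable_resolventKernel hz) g t =
      exp (z * t) • (c - ∫ r in (0 : ℝ)..t, exp (-z * r) • g r) := by
    by_cases hp : 0 < z.re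
    · have hi : ∀ a, IntegrableOn (fun r : ℝ => exp (-z * r) • g r) (Ioi a) := fun a =>
        integrableOn_exp_smul
          (integrableOn_exp_mul_complex_Ioi (by simpa using hp) a) g
      refine ⟨∫ r in Ioi (0 : ℝ), exp (-z * r) • g r, fun t => ?_⟩
      rw [conv_fun_eq_integral, ← intervalIntegral.integral_Ioi_sub_Ioi' (hi 0) (hi t),
        sub_sub_cancel, ← integral_smul, ← integral_indicator measurableSet_Ioi]
      congr 1 with r
      rw [resolventKernel, if_pos hp]
      by_cases hr : t < r
      · rw [indicator_of_mem (by simpa using hr), indicator_of_mem (by simpa using hr), hexp,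
          mul_smul]
      · rw [indicator_of_notMem (by simpa using hr), indicator_of_notMem (by simpa using hr),
          zero_smul]
    · have hn : z.re < 0 := lt_of_le_of_ne (not_lt.1 hp) hz
      have hi : ∀ a, IntegrableOn (fun r : ℝ => exp (-z * r) • g r) (Iic a) := fun a =>
        integrableOn_exp_smul
          (integrableOn_exp_mul_complex_Iic (by simpa using hn) a) g
      refine ⟨-∫ r in Iic (0 : ℝ), exp (-z * r) • g r, fun t => ?_⟩
      rw [conv_fun_eq_integral, ← intervalIntegral.integral_Iic_sub_Iic (hi 0) (hi t),
        neg_sub_left, sub_add_cancel, smul_neg, ← integral_smul,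
        ← integral_indicator measurableSet_Iic, ← integral_neg]
      congr 1 with r
      rw [resolventKernel, if_neg hp, Pi.neg_apply]
      by_cases hr : r ≤ t
      · rw [indicator_of_mem (by simpa using hr), indicator_of_mem (by simpa using hr), hexp,
          neg_smul, mul_smul]
      · rw [indicator_of_notMem (by simpa using hr), indicator_of_notMem (by simpa using hr),
          neg_zero, zero_smul, neg_zero]
  rw [isDerivResolvent_iff]
  intro t
  have := hasDerivAt_exp_mul_sub_integral z c g t
  rw [← hx] at this
  exact this.congr_of_eventuallyEq (.of_forall hx)

/-- The kernel of `∫_0^1 e^{z(1-s)} S(s) ds`. -/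
def unitKernel (z : ℂ) : ℝ → ℂ := (Ioc 0 1).indicator fun s : ℝ => exp (z * (1 - s))

theorem integrable_unitKernel (z : ℂ) : Integrable (unitKernel z) :=
  (integrable_indicator_iff measurableSet_Ioc).2
    ((by fun_prop : Continuous fun s : ℝ => exp (z * (1 - s))).integrableOn_Ioc)

/-- `(z - 𝒟) ∫_0^1 e^{z(1-s)} S(s) g ds = e^z g - S(1) g`. -/
theorem isDerivResolvent_unitKernel (z : ℂ) (g : BUC X) :
    IsDerivResolvent z (exp z • g - BUC.S 1 g)
      (BUC.conv (unitKernel z) (integrable_unitKernel z) g) := by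
  have hc : Continuous fun r : ℝ => exp (-z * r) • g r :=
    (by fun_prop : Continuous fun r : ℝ => exp (-z * r)).smul (BUC.continuous_fun g)
  -- The integral over `(t, t + 1]` is split at 0, which exhibits it as a combination of a solution
  -- of `x' = z x - g` with `c = 0` and its translate by 1.
  have hx : ∀ t, BUC.conv (unitKernel z) (integrable_unitKernel z) g t =
      exp z • (exp (z * t) • (0 - ∫ r in (0 : ℝ)..t, exp (-z * r) • g r)) -
        exp (z * (t + 1 : ℝ)) • (0 - ∫ r in (0 : ℝ)..(t + 1), exp (-z * r) • g r) := by
    intro t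
    have h1 : BUC.conv (unitKernel z) (integrable_unitKernel z) g t =
        exp (z * (t + 1 : ℝ)) • ∫ r in t..(t + 1), exp (-z * r) • g r := by
      rw [conv_fun_eq_integral, intervalIntegral.integral_of_le (by linarith), ← integral_smul,
        ← integral_indicator measurableSet_Ioc]
      congr 1 with r
      rw [unitKernel]
      by_cases hr : t < r ∧ r ≤ t + 1
      · rw [indicator_of_mem (by simp; constructor <;> linarith), indicator_of_mem (show r ∈ Ioc t (t + 1) from hr), smul_smul,
          ← Complex.exp_add]
        congr 2
        push_cast; ring
      · rw [indicator_of_notMem (fun h => hr ⟨by linarith [h.1], by linarith [h.2]⟩),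
          indicator_of_notMem (show r ∉ Ioc t (t + 1) from hr), zero_smul]
    rw [h1, ← intervalIntegral.integral_interval_sub_left (hc.intervalIntegrable 0 (t + 1))
      (hc.intervalIntegrable 0 t), smul_smul, ← Complex.exp_add]
    have : z + z * t = z * (t + 1 : ℝ) := by push_cast; ring
    rw [this, zero_sub, zero_sub, smul_neg, smul_neg, smul_sub]
    abel
  rw [isDerivResolvent_iff]
  intro t
  have h1 := (hasDerivAt_exp_mul_sub_integral z 0 g t).const_smul (exp z)
  have h2 := (hasDerivAt_exp_mul_sub_integral z 0 g (t + 1)).comp_add_const t 1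
  have h3 := (h1.sub h2).congr_of_eventuallyEq (.of_forall hx)
  convert! h3 using 1
  rw [BUC.sub_fun, BUC.smul_fun, hx, BUC.sub_fun, BUC.smul_fun, BUC.S_fun]
  module

/-- The kernel of the Abel means. -/
def abelKernel (ε ξ : ℝ) (s : ℝ) : ℂ := Real.exp (-ε * |s|) * exp (-(ξ * Complex.I) * s)

theorem abelKernel_eq {ε : ℝ} (hε : 0 < ε) (ξ : ℝ) :
    abelKernel ε ξ = fun s => resolventKernel (ε + ξ * Complex.I) s -
      resolventKernel (-ε + ξ * Complex.I) s := by
  ext1 s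
  have h1 : 0 < ((ε : ℂ) + ξ * Complex.I).re := by simpa using hε
  have h2 : ¬ 0 < (-(ε : ℂ) + ξ * Complex.I).re := by simpa using hε.le
  rw [resolventKernel, resolventKernel, if_pos h1, if_neg h2, abelKernel, Pi.neg_apply,
    sub_neg_eq_add, Complex.ofReal_exp, ← Complex.exp_add]
  by_cases hs : 0 < s
  · rw [indicator_of_mem (mem_Ioi.2 hs), indicator_of_notMem (by simpa using hs), add_zero, abs_of_pos hs]
    congr 1; push_cast; ring
  · rw [indicator_of_notMem (by simpa using hs), indicator_of_mem (mem_Iic.2 (not_lt.1 hs)), zero_add,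
      abs_of_nonpos (not_lt.1 hs)]
    congr 1; push_cast; ring

theorem integrable_abelKernel {ε : ℝ} (hε : 0 < ε) (ξ : ℝ) : Integrable (abelKernel ε ξ) := by
  rw [abelKernel_eq hε]
  exact (integrable_resolventKernel (by simpa using hε.ne')).sub
    (integrable_resolventKernel (by simpa using hε.ne'))

/-- This links the spectrum to Fourier analysis: the Abel mean is the jump of the resolvent across
the imaginary axis. -/
theorem integral_abelKernel_eq {ε : ℝ} (hε : 0 < ε) {ξ : ℝ} {g x₁ x₂ : BUC X}
    (h₁ : IsDerivResolvent (ε + ξ * Complex.I) g x₁)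
    (h₂ : IsDerivResolvent (-ε + ξ * Complex.I) g x₂) :
    ∫ s, abelKernel ε ξ s • BUC.S s g = x₁ - x₂ := by
  have e₁ : ((ε : ℂ) + ξ * Complex.I).re ≠ 0 := by simpa using hε.ne'
  have e₂ : (-(ε : ℂ) + ξ * Complex.I).re ≠ 0 := by simpa using hε.ne'
  rw [h₁.eq_conv e₁, h₂.eq_conv e₂, BUC.conv_def, BUC.conv_def, ← integral_sub
    (BUC.integrable_smul_S (integrable_resolventKernel e₁) g)
    (BUC.integrable_smul_S (integrable_resolventKernel e₂) g), abelKernel_eq hε]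
  simp only [BUC.sub_smul]

/-- Off the spectrum of `g` the Abel means of `g` tend to zero, uniformly on compact sets. -/
theorem tendstoUniformlyOn_abel (g : BUC X) {C : Set ℝ} (hC : IsCompact C)
    (hCg : Disjoint C (sp g)) :
    TendstoUniformlyOn (fun ε ξ => ∫ s, abelKernel ε ξ s • BUC.S s g) (fun _ => 0) (𝓝[>] 0) C := by
  rw [← tendstoLocallyUniformlyOn_iff_tendstoUniformlyOn_of_compact hC,
    Metric.tendstoLocallyUniformlyOn_iff]
  intro δ hδ ξ₀ hξ₀
  obtain ⟨U, F, hU, hm, hF, hr⟩ := not_not.1 (disjoint_left.1 hCg hξ₀)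
  have hcont := (hF _ hm).continuousAt
  have hmem : U ∩ F ⁻¹' Metric.ball (F (ξ₀ * Complex.I)) (δ / 2) ∈ 𝓝 ((ξ₀ : ℂ) * Complex.I) :=
    inter_mem (hU.mem_nhds hm) (hcont.preimage_mem_nhds (Metric.ball_mem_nhds _ (half_pos hδ)))
  -- Used with `σ = 1` and `σ = -1`: on both sides of the axis the resolvent is given by the same
  -- continuous `F`, so the jump tends to 0.
  have hmap : ∀ σ : ℝ, ∀ᶠ p : ℝ × ℝ in 𝓝 (0, ξ₀), ((σ * p.1 : ℝ) : ℂ) + p.2 * Complex.I ∈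
      U ∩ F ⁻¹' Metric.ball (F (ξ₀ * Complex.I)) (δ / 2) := by
    intro σ
    have : ContinuousAt (fun p : ℝ × ℝ => ((σ * p.1 : ℝ) : ℂ) + p.2 * Complex.I) (0, ξ₀) :=
      Continuous.continuousAt (by fun_prop)
    exact this.preimage_mem_nhds (by simpa using hmem)
  have hev := (hmap 1).and (hmap (-1))
  rw [nhds_prod_eq, eventually_prod_iff] at hev
  obtain ⟨pa, hpa, pb, hpb, H⟩ := hev
  refine ⟨{ξ | pb ξ}, mem_nhdsWithin_of_mem_nhds hpb, ?_⟩
  filter_upwards [mem_nhdsWithin_of_mem_nhds hpa, self_mem_nhdsWithin] with ε hε hε0 ξ hξ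
  have hε0 : 0 < ε := hε0
  obtain ⟨⟨m₁, d₁⟩, ⟨m₂, d₂⟩⟩ := H hε hξ
  simp only [one_mul, neg_mul, Complex.ofReal_neg] at m₁ m₂ d₁ d₂
  rw [integral_abelKernel_eq hε0 (hr _ m₁ (by simpa using hε0.ne'))
    (hr _ m₂ (by simpa using hε0.ne')), dist_comm, dist_zero_right, ← dist_eq_norm]
  have d₁' := Metric.mem_ball.1 d₁
  have d₂' := Metric.mem_ball.1 d₂
  linarith [dist_triangle_right (F (ε + ξ * Complex.I)) (F (-ε + ξ * Complex.I))
    (F (ξ₀ * Complex.I))]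

end Resolvent

/-! ### Functional calculus for absolutely convergent Fourier series -/

section Symbol

open Complex (exp)

/-- `T = ∑ c_j S(s_j)` and `h(ξ) = ∑ c_j e^{i s_j ξ}` with `∑ |c_j| < ∞`. -/
def HasSymbol {X : Type*} [NormedAddCommGroup X] [NormedSpace ℂ X]
    (T : BUC X →L[ℂ] BUC X) (h : ℝ → ℂ) : Prop :=
  ∃ (J : Type) (_ : Countable J) (c : J → ℂ) (s : J → ℝ), Summable (fun j => ‖c j‖) ∧
    (∀ g, HasSum (fun j => c j • BUC.S (s j) g) (T g)) ∧
    ∀ ξ : ℝ, HasSum (fun j => c j * exp (s j * ξ * Complex.I)) (h ξ)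

theorem hasSum_sumElim {α β E : Type*} [AddCommMonoid E] [TopologicalSpace E] [ContinuousAdd E]
    {f : α → E} {g : β → E} {a b : E} (hf : HasSum f a) (hg : HasSum g b) :
    HasSum (Sum.elim f g) (a + b) := by
  have h1 := (hasSum_extend_zero (Sum.inl_injective (α := α) (β := β))).2 hf
  have h2 := (hasSum_extend_zero (Sum.inr_injective (α := α) (β := β))).2 hg
  convert! h1.add h2 using 1
  ext (x | x)
  · simp [Sum.inl_injective.extend_apply, Function.extend_apply']
  · simp [Sum.inr_injective.extend_apply, Function.extend_apply']

variable {X : Type*} [NormedAddCommGroup X] [NormedSpace ℂ X] {T T' : BUC X →L[ℂ] BUC X}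
  {h h' : ℝ → ℂ}

theorem hasSymbol_S (a : ℝ) :
    HasSymbol (BUC.S a : BUC X →L[ℂ] BUC X) fun ξ => exp (a * ξ * Complex.I) := by
  refine ⟨Unit, inferInstance, fun _ => 1, fun _ => a, (hasSum_fintype _).summable, fun g => ?_,
    fun ξ => ?_⟩
  · convert! hasSum_fintype (fun _ : Unit => (1 : ℂ) • BUC.S a g) using 1
    exact BUC.ext_fun fun t => by simp
  · convert! hasSum_fintype (fun _ : Unit => (1 : ℂ) * exp (a * ξ * Complex.I)) using 1
    simp

theorem hasSymbol_id : HasSymbol (ContinuousLinearMap.id ℂ (BUC X)) fun _ => 1 := by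
  convert! hasSymbol_S (X := X) 0 using 1
  · ext1 g; simp
  · ext1 ξ; simp

theorem HasSymbol.smul (hT : HasSymbol T h) (a : ℂ) : HasSymbol (a • T) fun ξ => a * h ξ := by
  obtain ⟨J, hJ, c, s, hc, h1, h2⟩ := hT
  refine ⟨J, hJ, fun j => a * c j, s, by simpa using hc.mul_left ‖a‖, fun g => ?_, fun ξ => ?_⟩
  · simp only [mul_smul]
    exact (h1 g).const_smul a
  · simpa only [mul_assoc] using (h2 ξ).mul_left a

theorem HasSymbol.add (hT : HasSymbol T h) (hT' : HasSymbol T' h') :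
    HasSymbol (T + T') fun ξ => h ξ + h' ξ := by
  obtain ⟨J, hJ, c, s, hc, h1, h2⟩ := hT
  obtain ⟨J', hJ', c', s', hc', h1', h2'⟩ := hT'
  refine ⟨J ⊕ J', inferInstance, Sum.elim c c', Sum.elim s s', ?_, fun g => ?_, fun ξ => ?_⟩
  · convert! (hasSum_sumElim hc.hasSum hc'.hasSum).summable using 1
    ext (j | j) <;> rfl
  · convert! hasSum_sumElim (h1 g) (h1' g) using 1
    ext1 (j | j) <;> rfl
  · convert! hasSum_sumElim (h2 ξ) (h2' ξ) using 1
    ext1 (j | j) <;> rfl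

theorem HasSymbol.sub (hT : HasSymbol T h) (hT' : HasSymbol T' h') :
    HasSymbol (T - T') fun ξ => h ξ - h' ξ := by
  convert! hT.add (hT'.smul (-1)) using 1
  · ext1 g
    exact BUC.ext_fun fun t => by simp [sub_eq_add_neg]
  · ext1 ξ; simp [sub_eq_add_neg]

/-- An operator with a symbol commutes with every operator that commutes with translations. -/
theorem HasSymbol.map_comm (hT : HasSymbol T h) {C : BUC X →L[ℂ] BUC X} (hC : IsAutonomous C)
    (g : BUC X) : C (T g) = T (C g) := by
  obtain ⟨J, hJ, c, s, hc, h1, h2⟩ := hT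
  have := (h1 g).mapL C
  simp only [map_smul, hC _ g] at this
  exact this.unique (h1 (C g))

theorem HasSymbol.isAutonomous (hT : HasSymbol T h) : IsAutonomous T := fun s u =>
  (hT.map_comm (isAutonomous_S s) u).symm

theorem HasSymbol.continuous (hT : HasSymbol T h) : Continuous h := by
  obtain ⟨J, hJ, c, s, hc, h1, h2⟩ := hT
  have e : h = fun ξ : ℝ => ∑' j, c j * exp (s j * ξ * Complex.I) := funext fun ξ => (h2 ξ).tsum_eq.symm
  rw [e]
  refine continuous_tsum (fun j => by fun_prop) hc fun j ξ => ?_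
  rw [norm_mul, ← Complex.ofReal_mul, Complex.norm_exp_ofReal_mul_I, mul_one]

variable [CompleteSpace X]

theorem summable_smul_S {J : Type*} {c : J → ℂ} (hc : Summable fun j => ‖c j‖) (s : J → ℝ)
    (g : BUC X) : Summable fun j => c j • BUC.S (s j) g :=
  .of_norm_bounded (hc.mul_right ‖g‖) fun j => by
    rw [norm_smul]
    exact mul_le_mul_of_nonneg_left (BUC.norm_S_le _ g) (norm_nonneg _)

theorem HasSymbol.comp (hT : HasSymbol T h) (hT' : HasSymbol T' h') :
    HasSymbol (T.comp T') fun ξ => h ξ * h' ξ := by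
  obtain ⟨J, hJ, c, s, hc, h1, h2⟩ := hT
  obtain ⟨J', hJ', c', s', hc', h1', h2'⟩ := hT'
  have hcc : Summable fun p : J × J' => ‖c p.1 * c' p.2‖ := hc.mul_norm hc'
  refine ⟨J × J', inferInstance, fun p => c p.1 * c' p.2, fun p => s p.1 + s' p.2, hcc,
    fun g => ?_, fun ξ => ?_⟩
  · have hs := (summable_smul_S hcc (fun p => s p.1 + s' p.2) g).hasSum
    have h3 := hs.prod_fiberwise (g := fun j => c j • BUC.S (s j) (T' g)) fun j => by
      have := ((h1' g).mapL (BUC.S (s j))).const_smul (c j)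
      simpa only [map_smul, BUC.S_S, smul_smul] using this
    rwa [h3.unique (h1 (T' g))] at hs
  · have hn : Summable fun p : J × J' => c p.1 * c' p.2 * exp ((s p.1 + s' p.2 : ℝ) * ξ * Complex.I) :=
      .of_norm_bounded hcc fun p => by
        rw [norm_mul _ (exp _), ← Complex.ofReal_mul, Complex.norm_exp_ofReal_mul_I, mul_one]
    have hs := hn.hasSum
    have h3 := hs.prod_fiberwise (g := fun j => c j * exp (s j * ξ * Complex.I) * h' ξ) fun j => by
      convert! (h2' ξ).mul_left (c j * exp (s j * ξ * Complex.I)) using 1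
      ext1 j'
      push_cast
      rw [add_mul, add_mul, Complex.exp_add]
      ring
    rwa [h3.unique ((h2 ξ).mul_right (h' ξ))] at hs

end Symbol

/-! ### Operators whose symbol vanishes near the spectrum -/

section Vanishing

open Complex (exp)
open scoped FourierTransform SchwartzMap ContDiff

variable {X : Type*} [NormedAddCommGroup X] [NormedSpace ℂ X]

theorem norm_exp_ofReal_mul_mul_I (a b : ℝ) : ‖exp (a * b * Complex.I)‖ = 1 := by
  rw [← Complex.ofReal_mul, Complex.norm_exp_ofReal_mul_I]

theorem norm_abelKernel (ε ξ s : ℝ) : ‖abelKernel ε ξ s‖ = Real.exp (-ε * |s|) := by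
  rw [abelKernel, norm_mul, Complex.norm_real, Real.norm_of_nonneg (Real.exp_pos _).le,
    Complex.norm_exp]
  simp

theorem integrable_exp_neg_abs {ε : ℝ} (hε : 0 < ε) :
    Integrable fun s : ℝ => Real.exp (-ε * |s|) := by
  simpa only [norm_abelKernel] using (integrable_abelKernel hε 0).norm

theorem continuous_abelKernel_uncurry (ε : ℝ) :
    Continuous fun p : ℝ × ℝ => abelKernel ε p.1 p.2 := by
  unfold abelKernel
  fun_prop

/-- The Abel mean of `g` at the frequency `ξ`. -/
def abelMean (g : BUC X) (ε ξ : ℝ) : BUC X := ∫ s, abelKernel ε ξ s • BUC.S s g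

theorem continuous_abelMean (g : BUC X) {ε : ℝ} (hε : 0 < ε) : Continuous (abelMean g ε) := by
  refine continuous_of_dominated (bound := fun s => Real.exp (-ε * |s|) * ‖g‖) (fun ξ => ?_)
    (fun ξ => .of_forall fun s => ?_) ((integrable_exp_neg_abs hε).mul_const _)
    (.of_forall fun s => ?_)
  · exact ((continuous_abelKernel_uncurry ε).comp (by fun_prop : Continuous fun s : ℝ => (ξ, s))
      |>.smul (BUC.continuous_S g)).aestronglyMeasurable
  · rw [norm_smul, norm_abelKernel]
    exact mul_le_mul_of_nonneg_left (BUC.norm_S_le s g) (Real.exp_pos _).le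
  · exact ((continuous_abelKernel_uncurry ε).comp
      (by fun_prop : Continuous fun ξ : ℝ => (ξ, s))).smul continuous_const

theorem norm_abelMean_le (g : BUC X) {ε : ℝ} (hε : 0 < ε) (ξ : ℝ) :
    ‖abelMean g ε ξ‖ ≤ (∫ s, Real.exp (-ε * |s|)) * ‖g‖ := by
  rw [← integral_mul_const]
  refine norm_integral_le_of_norm_le ((integrable_exp_neg_abs hε).mul_const _)
    (.of_forall fun s => ?_)
  rw [norm_smul, norm_abelKernel]
  exact mul_le_mul_of_nonneg_left (BUC.norm_S_le s g) (Real.exp_pos _).le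

variable {τ κ : ℝ → ℂ}

theorem norm_kernel_exp_smul_S_le {ε : ℝ} (hε : 0 ≤ ε) (a s : ℝ) (g : BUC X) :
    ‖(κ s * Real.exp (-ε * |s + a|)) • BUC.S (s + a) g‖ ≤ ‖κ s‖ * ‖g‖ := by
  rw [norm_smul, norm_mul, Complex.norm_real, Real.norm_of_nonneg (Real.exp_pos _).le]
  refine mul_le_mul (mul_le_of_le_one_right (norm_nonneg _) ?_) (BUC.norm_S_le _ g)
    (norm_nonneg _) (norm_nonneg _)
  rw [Real.exp_le_one_iff, neg_mul, neg_nonpos]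
  positivity

theorem aestronglyMeasurable_kernel_exp_smul_S (hκ : Integrable κ) (ε a : ℝ) (g : BUC X) :
    AEStronglyMeasurable (fun s => (κ s * Real.exp (-ε * |s + a|)) • BUC.S (s + a) g) volume :=
  (hκ.aestronglyMeasurable.mul
    (by fun_prop : Continuous fun s : ℝ => ((Real.exp (-ε * |s + a|) : ℝ) : ℂ)).aestronglyMeasurable).smul
    ((BUC.continuous_S g).comp (continuous_add_const a)).aestronglyMeasurable

variable [CompleteSpace X]

/-- Fubini after inserting the Fourier integral for `κ`; the damping factor makes the double
integral absolutely convergent. The shift by `a` appears on the frequency side as the factor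
`e^{iaξ}`. -/
theorem integral_kernel_exp_smul_S (hτc : Continuous τ) (hτ : HasCompactSupport τ)
    (hκτ : ∀ s : ℝ, κ s = ∫ ξ : ℝ, τ ξ * exp (-(ξ * Complex.I) * s)) {ε : ℝ} (hε : 0 < ε)
    (a : ℝ) (g : BUC X) :
    ∫ s, (κ s * Real.exp (-ε * |s + a|)) • BUC.S (s + a) g =
      ∫ ξ : ℝ, (τ ξ * exp (a * ξ * Complex.I)) • abelMean g ε ξ := by
  have hτi : Integrable τ := hτc.integrable_of_hasCompactSupport hτ
  have e1 : ∀ s : ℝ, (κ s * Real.exp (-ε * |s + a|)) • BUC.S (s + a) g =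
      ∫ ξ : ℝ, (τ ξ * exp (a * ξ * Complex.I)) • (abelKernel ε ξ (s + a) • BUC.S (s + a) g) := by
    intro s
    rw [hκτ, ← integral_mul_const, ← BUC.integral_smul_const]
    congr 1
    ext1 ξ
    have e : exp (-(ξ * Complex.I) * s) =
        exp (a * ξ * Complex.I) * exp (-(ξ * Complex.I) * (s + a : ℝ)) := by
      rw [← Complex.exp_add]; push_cast; ring_nf
    rw [smul_smul, abelKernel, e]
    congr 1
    ring
  have hc : Continuous fun p : ℝ × ℝ => (τ p.2 * exp (a * p.2 * Complex.I)) •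
      (abelKernel ε p.2 (p.1 + a) • BUC.S (p.1 + a) g) := by
    refine Continuous.fun_smul ((hτc.comp continuous_snd).mul (by fun_prop)) (Continuous.fun_smul ?_ ?_)
    · exact (continuous_abelKernel_uncurry ε).comp
        (by fun_prop : Continuous fun p : ℝ × ℝ => (p.2, p.1 + a))
    · exact (BUC.continuous_S g).comp (by fun_prop : Continuous fun p : ℝ × ℝ => p.1 + a)
  have hi : Integrable (Function.uncurry fun s ξ : ℝ => (τ ξ * exp (a * ξ * Complex.I)) •
      (abelKernel ε ξ (s + a) • BUC.S (s + a) g)) (volume.prod volume) := by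
    have hb : Integrable (fun p : ℝ × ℝ => (Real.exp (-ε * |p.1 + a|) * ‖g‖) * ‖τ p.2‖)
        (volume.prod volume) :=
      (((integrable_exp_neg_abs hε).comp_add_right a).mul_const ‖g‖).mul_prod hτi.norm
    refine hb.mono' hc.aestronglyMeasurable (.of_forall fun p => ?_)
    rw [Function.uncurry, norm_smul, norm_smul, norm_mul, norm_exp_ofReal_mul_mul_I, mul_one,
      norm_abelKernel, mul_comm]
    gcongr
    exact BUC.norm_S_le _ g
  simp_rw [e1]
  rw [integral_integral_swap hi]
  congr 1; ext1 ξ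
  rw [integral_smul, integral_add_right_eq_self (fun s => abelKernel ε ξ s • BUC.S s g), abelMean]

/-- With damping `ε`, the smoothed `T g` becomes `∫ τ(ξ) h(ξ) abelMean g ε ξ dξ`. The factor `τ h`
lives on a compact set off `sp g`, where the Abel means tend to 0 uniformly. -/
theorem HasSymbol.conv_eq_zero {T : BUC X →L[ℂ] BUC X} {h : ℝ → ℂ} (hT : HasSymbol T h)
    {V : Set ℝ} (hV : IsOpen V) (hV0 : ∀ ξ ∈ V, h ξ = 0) {g : BUC X} (hg : sp g ⊆ V)
    (hτc : Continuous τ) (hτ : HasCompactSupport τ) (hκ : Integrable κ)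
    (hκτ : ∀ s : ℝ, κ s = ∫ ξ : ℝ, τ ξ * exp (-(ξ * Complex.I) * s)) :
    BUC.conv κ hκ (T g) = 0 := by
  have hhc := hT.continuous
  obtain ⟨J, hJ, c, s, hc, h1, h2⟩ := hT
  have hτi : Integrable τ := hτc.integrable_of_hasCompactSupport hτ
  -- The damping is taken at the total translation `r + s j`, so that a change of variable yields
  -- the same Abel mean for every `j`.
  set I : ℝ → J → BUC X := fun ε j =>
    c j • ∫ r, (κ r * Real.exp (-ε * |r + s j|)) • BUC.S (r + s j) g with hI
  have hlim1 : Tendsto (fun ε => ∑' j, I ε j) (𝓝[>] 0) (𝓝 (BUC.conv κ hκ (T g))) := by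
    have hsum : HasSum (fun j => c j • ∫ r, κ r • BUC.S (r + s j) g) (BUC.conv κ hκ (T g)) := by
      have := (h1 g).mapL (BUC.conv κ hκ)
      simpa only [map_smul, BUC.conv_def, BUC.S_S] using this
    rw [← hsum.tsum_eq]
    refine tendsto_tsum_of_dominated_convergence (bound := fun j => ‖c j‖ * ∫ r, ‖κ r‖ * ‖g‖)
      (hc.mul_right _) (fun j => ?_) ?_
    · refine Tendsto.const_smul ?_ _
      refine tendsto_integral_filter_of_dominated_convergence (fun r => ‖κ r‖ * ‖g‖)
        (.of_forall fun ε => aestronglyMeasurable_kernel_exp_smul_S hκ ε _ g) ?_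
        (hκ.norm.mul_const _) (.of_forall fun r => ?_)
      · filter_upwards [self_mem_nhdsWithin] with ε hε
        exact .of_forall fun r => norm_kernel_exp_smul_S_le (le_of_lt hε) _ r g
      · have : Continuous fun ε : ℝ => (κ r * (Real.exp (-ε * |r + s j|) : ℝ)) • BUC.S (r + s j) g :=
          Continuous.fun_smul (by fun_prop) continuous_const
        simpa using (this.tendsto 0).mono_left nhdsWithin_le_nhds
    · filter_upwards [self_mem_nhdsWithin] with ε hε j
      rw [hI, norm_smul]
      exact mul_le_mul_of_nonneg_left (norm_integral_le_of_norm_le (hκ.norm.mul_const _)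
        (.of_forall fun r => norm_kernel_exp_smul_S_le (le_of_lt hε) _ r g)) (norm_nonneg _)
  have heq : ∀ᶠ ε in 𝓝[>] (0 : ℝ), ∫ ξ : ℝ, (τ ξ * h ξ) • abelMean g ε ξ = ∑' j, I ε j := by
    filter_upwards [self_mem_nhdsWithin] with ε hε
    have hε : 0 < ε := hε
    set C : ℝ := (∫ s, Real.exp (-ε * |s|)) * ‖g‖
    have hbound : ∀ j ξ, ‖(c j * (τ ξ * exp (s j * ξ * Complex.I))) • abelMean g ε ξ‖ ≤
        ‖c j‖ * (‖τ ξ‖ * C) := by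
      intro j ξ
      rw [norm_smul, norm_mul, norm_mul, norm_exp_ofReal_mul_mul_I, mul_one, mul_assoc]
      gcongr
      exact norm_abelMean_le g hε ξ
    have hbi : ∀ j, Integrable fun ξ => ‖c j‖ * (‖τ ξ‖ * C) := fun j =>
      (hτi.norm.mul_const C).const_mul _
    have hint : ∀ j, Integrable fun ξ : ℝ =>
        (c j * (τ ξ * exp (s j * ξ * Complex.I))) • abelMean g ε ξ := fun j =>
      (hbi j).mono' (Continuous.aestronglyMeasurable
        (Continuous.fun_smul (by fun_prop) (continuous_abelMean g hε))) (.of_forall (hbound j))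
    have key := hasSum_integral_of_summable_integral_norm hint
      (.of_nonneg_of_le (fun j => by positivity)
        (fun j => integral_mono (hint j).norm (hbi j) (hbound j)) (by
          simp_rw [integral_const_mul]
          exact hc.mul_right _))
    have e1 : ∀ j, ∫ ξ : ℝ, (c j * (τ ξ * exp (s j * ξ * Complex.I))) • abelMean g ε ξ = I ε j := by
      intro j
      simp_rw [mul_smul (c j)]
      rw [integral_smul, ← integral_kernel_exp_smul_S hτc hτ hκτ hε]
    have e2 : ∀ ξ : ℝ, ∑' j, (c j * (τ ξ * exp (s j * ξ * Complex.I))) • abelMean g ε ξ =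
        (τ ξ * h ξ) • abelMean g ε ξ := by
      intro ξ
      refine HasSum.tsum_eq (HasSum.smul_const ?_ _)
      convert! (h2 ξ).mul_left (τ ξ) using 2
      ring
    simp_rw [e1, e2] at key
    exact key.tsum_eq.symm
  have hlim2 : Tendsto (fun ε => ∫ ξ : ℝ, (τ ξ * h ξ) • abelMean g ε ξ) (𝓝[>] 0) (𝓝 0) := by
    have hK : IsCompact (tsupport τ \ V) := hτ.isCompact.diff hV
    have hunif := tendstoUniformlyOn_abel g hK (disjoint_left.2 fun ξ hξ hs => hξ.2 (hg hs))
    rw [Metric.tendstoUniformlyOn_iff] at hunif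
    have hthi : Integrable fun ξ => ‖τ ξ * h ξ‖ :=
      ((hτc.mul hhc).integrable_of_hasCompactSupport (hτ.mul_right)).norm
    rw [Metric.tendsto_nhds]
    intro δ hδ
    set M : ℝ := ∫ ξ, ‖τ ξ * h ξ‖ with hM
    have hM0 : 0 ≤ M := integral_nonneg fun _ => norm_nonneg _
    filter_upwards [hunif (δ / (M + 1)) (by positivity)] with ε hε
    rw [dist_zero_right]
    have : ‖∫ ξ : ℝ, (τ ξ * h ξ) • abelMean g ε ξ‖ ≤ M * (δ / (M + 1)) := by
      rw [hM, ← integral_mul_const]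
      refine norm_integral_le_of_norm_le (hthi.mul_const _) (.of_forall fun ξ => ?_)
      rw [norm_smul]
      by_cases hξ : ξ ∈ tsupport τ \ V
      · refine mul_le_mul_of_nonneg_left ?_ (norm_nonneg _)
        have := hε ξ hξ
        rw [dist_zero_left] at this
        exact this.le
      · have : τ ξ * h ξ = 0 := by
          by_cases hξV : ξ ∈ V
          · rw [hV0 ξ hξV, mul_zero]
          · rw [image_eq_zero_of_notMem_tsupport fun h => hξ ⟨h, hξV⟩, zero_mul]
        simp [this]
    refine this.trans_lt ?_
    rw [mul_div_assoc', div_lt_iff₀ (by positivity)]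
    nlinarith
  exact tendsto_nhds_unique (hlim1.congr' (heq.mono fun _ h => h.symm)) hlim2

/-- There is an approximate identity consisting of kernels whose Fourier transforms have compact
support. -/
theorem exists_kernel :
    ∃ (k : ℝ → ℂ) (_ : Integrable k), ∫ r, k r = 1 ∧ ∀ b : ℝ, 0 < b → ∃ τ : ℝ → ℂ, Continuous τ ∧
      HasCompactSupport τ ∧
      ∀ s : ℝ, (b : ℂ)⁻¹ * k (b⁻¹ * s) = ∫ ξ : ℝ, τ ξ * exp (-(ξ * Complex.I) * s) := by
  let φ : ContDiffBump (0 : ℝ) := ⟨1, 2, one_pos, one_lt_two⟩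
  have hφs : HasCompactSupport fun x => (φ x : ℂ) :=
    φ.hasCompactSupport.comp_left (g := fun x : ℝ => (x : ℂ)) Complex.ofReal_zero
  have hφd : ContDiff ℝ ∞ fun x => (φ x : ℂ) := Complex.ofRealCLM.contDiff.comp φ.contDiff
  let σ : 𝓢(ℝ, ℂ) := hφs.toSchwartzMap hφd
  refine ⟨(𝓕 σ : 𝓢(ℝ, ℂ)), (𝓕 σ).integrable, ?_, fun b hb => ?_⟩
  · have h1 : 𝓕⁻ (𝓕 σ) 0 = σ 0 := by rw [FourierTransform.fourierInv_fourier_eq]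
    rw [SchwartzMap.fourierInv_coe, Real.fourierInv_eq'] at h1
    simp only [inner_zero_right, mul_zero, Complex.ofReal_zero, zero_mul, Complex.exp_zero,
      one_smul] at h1
    rw [h1]
    change ((φ 0 : ℝ) : ℂ) = 1
    rw [φ.one_of_mem_closedBall (by simp [φ])]
    simp
  · have hb2 : b / (2 * Real.pi) ≠ 0 := by positivity
    -- The Fourier transform uses `e^{-2πixη}`; the substitution `ξ = 2πη/b` dictates the constants.
    refine ⟨fun ξ => (1 / (2 * Real.pi) : ℝ) * σ (b / (2 * Real.pi) * ξ), ?_, ?_, fun s => ?_⟩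
    · exact continuous_const.mul (σ.continuous.comp (continuous_const_mul _))
    · exact (hφs.comp_homeomorph (Homeomorph.mulLeft₀ _ hb2)).mul_left
    · have e := Measure.integral_comp_mul_left
        (fun η : ℝ => ((1 / (2 * Real.pi) : ℝ) * σ η) * exp (-((2 * Real.pi / b * η : ℝ) * Complex.I) * s))
        (b / (2 * Real.pi))
      have e2 : ∀ ξ : ℝ, 2 * Real.pi / b * (b / (2 * Real.pi) * ξ) = ξ := fun ξ => by
        field_simp
      simp only [e2] at e
      rw [e, SchwartzMap.fourier_coe, Real.fourier_eq', abs_of_pos (by positivity)]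
      rw [← integral_smul, ← integral_const_mul]
      congr 1 with η
      simp only [RCLike.inner_apply, conj_trivial, Complex.real_smul, smul_eq_mul]
      have : (-((2 * Real.pi / b * η : ℝ) * Complex.I) * s : ℂ) =
          (-2 * Real.pi * (b⁻¹ * s * η) : ℝ) * Complex.I := by
        push_cast; field_simp
      rw [this]
      have hb' : (b : ℂ) ≠ 0 := by exact_mod_cast hb.ne'
      have hpi : (Real.pi : ℂ) ≠ 0 := by exact_mod_cast Real.pi_ne_zero
      push_cast
      field_simp

/-- If the symbol of `T` vanishes near the spectrum of `g` then `T g = 0`. -/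
theorem HasSymbol.apply_eq_zero {T : BUC X →L[ℂ] BUC X} {h : ℝ → ℂ} (hT : HasSymbol T h)
    {V : Set ℝ} (hV : IsOpen V) (hV0 : ∀ ξ ∈ V, h ξ = 0) {g : BUC X} (hg : sp g ⊆ V) :
    T g = 0 := by
  obtain ⟨k, hk, hk1, hkb⟩ := exists_kernel
  -- This is the smoothing at scale `b`, after the substitution `s = b r`. As `b → 0+` it tends to
  -- `(∫ k) • T g = T g`.
  have hzero : ∀ b > 0, ∫ r, k r • BUC.S (b * r) (T g) = 0 := by
    intro b hb
    obtain ⟨τ, hτc, hτ, hκτ⟩ := hkb b hb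
    have hκ : Integrable fun s => (b : ℂ)⁻¹ * k (b⁻¹ * s) :=
      (hk.comp_mul_left' (inv_ne_zero hb.ne')).const_mul _
    have e := hT.conv_eq_zero hV hV0 hg hτc hτ hκ hκτ
    rw [BUC.conv_def] at e
    have e2 := Measure.integral_comp_mul_left
      (fun s => ((b : ℂ)⁻¹ * k (b⁻¹ * s)) • BUC.S s (T g)) b
    rw [e, smul_zero] at e2
    simp only [inv_mul_cancel_left₀ hb.ne', mul_smul] at e2
    rw [integral_smul] at e2
    exact (smul_eq_zero.1 e2).resolve_left (by simpa using hb.ne')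
  have hlim : Tendsto (fun b => ∫ r, k r • BUC.S (b * r) (T g)) (𝓝[>] 0)
      (𝓝 (∫ r, k r • BUC.S (0 * r) (T g))) := by
    refine tendsto_integral_filter_of_dominated_convergence (fun r => ‖k r‖ * ‖T g‖)
      (.of_forall fun b => ?_) (.of_forall fun b => .of_forall fun r => ?_) (hk.norm.mul_const _)
      (.of_forall fun r => ?_)
    · exact hk.aestronglyMeasurable.smul
        ((BUC.continuous_S _).comp (continuous_const_mul b)).aestronglyMeasurable
    · rw [norm_smul]
      exact mul_le_mul_of_nonneg_left (BUC.norm_S_le _ _) (norm_nonneg _)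
    · exact (((BUC.continuous_S _).comp (continuous_mul_const r)).tendsto 0).mono_left
        nhdsWithin_le_nhds |>.const_smul (k r)
  simp only [zero_mul, BUC.S_zero] at hlim
  rw [BUC.integral_smul_const, hk1] at hlim
  have h0 : Tendsto (fun b => ∫ r, k r • BUC.S (b * r) (T g)) (𝓝[>] 0) (𝓝 0) :=
    tendsto_const_nhds.congr' (by
      filter_upwards [self_mem_nhdsWithin] with b hb using (hzero b hb).symm)
  have := tendsto_nhds_unique hlim h0
  exact BUC.ext_fun fun t => by simpa using congrArg (fun x : BUC X => x t) this

end Vanishing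

/-! ### Smooth functions on the circle as symbols -/

section Smooth

open Complex (exp)
open scoped ContDiff

/-- Integration by parts; periodicity cancels the boundary terms. Applied twice, it gives
coefficients of order `n⁻²`. -/
theorem fourierCoeffOn_deriv_of_periodic {f f' : ℝ → ℂ} (hf : ∀ x, HasDerivAt f (f' x) x)
    (hf' : Continuous f') (hper : f (2 * Real.pi) = f 0) {n : ℤ} (hn : n ≠ 0) :
    fourierCoeffOn Real.two_pi_pos f n = fourierCoeffOn Real.two_pi_pos f' n / (n * Complex.I) := by
  rw [fourierCoeffOn_of_hasDerivAt Real.two_pi_pos hn (fun x _ => hf x)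
    (hf'.intervalIntegrable _ _), hper]
  have h1 : (n : ℂ) ≠ 0 := by exact_mod_cast hn
  have h2 : (Real.pi : ℂ) ≠ 0 := by exact_mod_cast Real.pi_ne_zero
  push_cast
  field_simp
  ring_nf

theorem norm_fourierCoeffOn_le {f : ℝ → ℂ} {C : ℝ} (hC : ∀ x ∈ Icc 0 (2 * Real.pi), ‖f x‖ ≤ C)
    (n : ℤ) : ‖fourierCoeffOn Real.two_pi_pos f n‖ ≤ C := by
  have hpi := Real.two_pi_pos
  rw [fourierCoeffOn_eq_integral, norm_smul, sub_zero, Real.norm_of_nonneg (by positivity)]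
  have : ‖∫ x in (0 : ℝ)..2 * Real.pi, fourier (-n) (x : AddCircle (2 * Real.pi - 0)) • f x‖ ≤
      C * |2 * Real.pi - 0| := by
    refine intervalIntegral.norm_integral_le_of_norm_le_const fun x hx => ?_
    rw [norm_smul, fourier_apply, Circle.norm_coe, one_mul]
    rw [uIoc_of_le hpi.le] at hx
    exact hC x (Ioc_subset_Icc_self hx)
  rw [sub_zero, abs_of_pos hpi] at this
  calc _ ≤ 1 / (2 * Real.pi) * (C * (2 * Real.pi)) := by gcongr
    _ = C := by field_simp

/-- A smooth function on the circle has an absolutely convergent Fourier series. -/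
theorem exists_fourier_series {H : ℂ → ℂ} (hH : ContDiff ℝ ∞ H) :
    ∃ a : ℤ → ℂ, Summable (fun n => ‖a n‖) ∧
      ∀ ξ : ℝ, HasSum (fun n : ℤ => a n * exp ((n : ℝ) * ξ * Complex.I))
        (H (exp (ξ * Complex.I))) := by
  have hpi := Real.two_pi_pos
  set f : ℝ → ℂ := fun ξ => H (exp (ξ * Complex.I)) with hf
  have hfd : ContDiff ℝ ∞ f := hH.comp (Complex.contDiff_exp.comp
    ((Complex.ofRealCLM.contDiff (n := ∞)).mul contDiff_const))
  have hper : Function.Periodic f (2 * Real.pi) := fun ξ => by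
    simp only [hf]
    congr 1
    rw [Complex.ofReal_add, add_mul]
    push_cast
    exact Complex.exp_periodic _
  have hd1 : ContDiff ℝ ∞ (deriv f) := ((contDiff_infty_iff_deriv).1 hfd).2
  have hd2 : ContDiff ℝ ∞ (deriv (deriv f)) := ((contDiff_infty_iff_deriv).1 hd1).2
  have hper1 : Function.Periodic (deriv f) (2 * Real.pi) := fun ξ => by
    rw [← deriv_comp_add_const]
    exact congrArg (fun F => deriv F ξ) (funext hper)
  obtain ⟨C, hC⟩ := isCompact_Icc.exists_bound_of_continuousOn (s := Icc 0 (2 * Real.pi))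
    hd2.continuous.continuousOn
  have hsum : Summable fun n : ℤ => ‖fourierCoeffOn hpi f n‖ := by
    refine Summable.of_norm_bounded_eventually
      (((Real.summable_one_div_int_pow (p := 2)).2 one_lt_two).mul_left C) ?_
    filter_upwards [(finite_singleton (0 : ℤ)).compl_mem_cofinite] with n hn
    have hn : n ≠ 0 := hn
    rw [norm_norm, fourierCoeffOn_deriv_of_periodic
      (fun x => ((contDiff_infty_iff_deriv).1 hfd).1.differentiableAt.hasDerivAt) hd1.continuous
      (by simpa using hper 0) hn, fourierCoeffOn_deriv_of_periodic
      (fun x => ((contDiff_infty_iff_deriv).1 hd1).1.differentiableAt.hasDerivAt) hd2.continuous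
      (by simpa using hper1 0) hn, norm_div, norm_div, norm_mul, Complex.norm_I, mul_one,
      Complex.norm_intCast, div_div, ← sq, sq_abs, mul_one_div]
    exact div_le_div_of_nonneg_right (norm_fourierCoeffOn_le hC n) (sq_nonneg _)
  have : Fact (0 < 2 * Real.pi) := ⟨hpi⟩
  let F : C(AddCircle (2 * Real.pi), ℂ) := ⟨hper.lift, continuous_coinduced_dom.2 (by
    exact hfd.continuous)⟩
  have hcoef : ∀ n, fourierCoeff F n = fourierCoeffOn hpi f n := by
    intro n
    rw [fourierCoeffOn_eq_integral, fourierCoeff_eq_intervalIntegral _ n 0, zero_add, sub_zero]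
    congr 1
  refine ⟨fun n => fourierCoeffOn hpi f n, hsum, fun ξ => ?_⟩
  have := has_pointwise_sum_fourier_series_of_summable (f := F)
    ((funext hcoef : fourierCoeff F = _) ▸ hsum.of_norm) (ξ : AddCircle (2 * Real.pi))
  have e : F (ξ : AddCircle (2 * Real.pi)) = f ξ := rfl
  rw [e] at this
  convert! this using 2 with n
  rw [hcoef, fourier_coe_apply, smul_eq_mul]
  congr 2
  have h2 : (Real.pi : ℂ) ≠ 0 := by exact_mod_cast Real.pi_ne_zero
  push_cast
  field_simp

variable {X : Type*} [NormedAddCommGroup X] [NormedSpace ℂ X] [CompleteSpace X]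

theorem exists_forall_hasSum_smul_S {a : ℤ → ℂ} (ha : Summable fun n => ‖a n‖) :
    ∃ T : BUC X →L[ℂ] BUC X, ∀ g, HasSum (fun n : ℤ => a n • BUC.S (n : ℝ) g) (T g) := by
  let T : BUC X →ₗ[ℂ] BUC X :=
    { toFun := fun g => ∑' n : ℤ, a n • BUC.S (n : ℝ) g
      map_add' := fun g g' => by
        simp only [map_add, smul_add]
        exact (summable_smul_S ha _ g).tsum_add (summable_smul_S ha _ g')
      map_smul' := fun c g => by
        simp only [map_smul, smul_comm _ c, RingHom.id_apply]
        exact (summable_smul_S ha _ g).tsum_const_smul c }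
  refine ⟨T.mkContinuous (∑' n, ‖a n‖) fun g => ?_, fun g => (summable_smul_S ha _ g).hasSum⟩
  rw [← tsum_mul_right]
  refine tsum_of_norm_bounded (ha.mul_right _).hasSum fun n => ?_
  rw [norm_smul]
  exact mul_le_mul_of_nonneg_left (BUC.norm_S_le _ g) (norm_nonneg _)

theorem exists_hasSymbol {H : ℂ → ℂ} (hH : ContDiff ℝ ∞ H) :
    ∃ T : BUC X →L[ℂ] BUC X, HasSymbol T fun ξ => H (exp (ξ * Complex.I)) := by
  obtain ⟨a, ha, hs⟩ := exists_fourier_series hH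
  obtain ⟨T, hT⟩ := exists_forall_hasSum_smul_S (X := X) ha
  exact ⟨T, ℤ, inferInstance, a, fun n => n, ha, hT, hs⟩

/-- The values are prescribed on neighbourhoods because locality of the calculus needs symbols that
agree on an open set. -/
theorem exists_smooth_zero_one {s t : Set ℂ} (hs : IsClosed s) (ht : IsClosed t)
    (hd : Disjoint s t) : ∃ φ : ℂ → ℂ, ContDiff ℝ ∞ φ ∧ (∀ᶠ w in 𝓝ˢ s, φ w = 0) ∧
      ∀ᶠ w in 𝓝ˢ t, φ w = 1 := by
  obtain ⟨φ, h0, h1, -⟩ := exists_contMDiffMap_zero_one_nhds_of_isClosed (n := ⊤)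
    (modelWithCornersSelf ℝ ℂ) hs ht hd
  refine ⟨fun w => φ w, Complex.ofRealCLM.contDiff.comp φ.contMDiff.contDiff, ?_, ?_⟩
  · filter_upwards [h0] with w hw using by rw [hw, Complex.ofReal_zero]
  · filter_upwards [h1] with w hw using by rw [hw, Complex.ofReal_one]

/-- A cutoff that vanishes near `z` removes the pole of `(z - w)⁻¹`. -/
theorem exists_smooth_inverse {z : ℂ} {t : Set ℂ} (ht : IsClosed t) (hz : z ∉ t) :
    ∃ ψ : ℂ → ℂ, ContDiff ℝ ∞ ψ ∧ ∀ᶠ w in 𝓝ˢ t, (z - w) * ψ w = 1 := by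
  obtain ⟨φ, hφ, h0, h1⟩ := exists_smooth_zero_one isClosed_singleton ht
    (disjoint_singleton_left.2 hz)
  rw [nhdsSet_singleton] at h0
  refine ⟨fun w => φ w * (z - w)⁻¹, contDiff_iff_contDiffAt.2 fun w => ?_, ?_⟩
  · by_cases hw : w = z
    · subst hw
      refine (contDiffAt_const (c := (0 : ℂ))).congr_of_eventuallyEq ?_
      filter_upwards [h0] with v hv using by rw [hv, zero_mul]
    · exact hφ.contDiffAt.mul ((contDiffAt_const.sub contDiffAt_id).inv
        (sub_ne_zero.2 (Ne.symm hw)))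
  · have hz' : ∀ᶠ w in 𝓝ˢ t, w ≠ z := isOpen_ne.mem_nhdsSet.2 fun w hw h => hz (h ▸ hw)
    filter_upwards [h1, hz'] with w hw hwz
    rw [hw, one_mul, mul_inv_cancel₀ (sub_ne_zero.2 (Ne.symm hwz))]

/-- Operators whose symbols agree near `K` agree on functions with spectrum in `K`. -/
theorem HasSymbol.apply_eq_apply {T₁ T₂ : BUC X →L[ℂ] BUC X} {H₁ H₂ : ℂ → ℂ}
    (h₁ : HasSymbol T₁ fun ξ => H₁ (exp (ξ * Complex.I)))
    (h₂ : HasSymbol T₂ fun ξ => H₂ (exp (ξ * Complex.I))) {K : Set ℂ}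
    (hH : ∀ᶠ w in 𝓝ˢ K, H₁ w = H₂ w) {g : BUC X} (hg : sp g ⊆ expPreimage K) :
    T₁ g = T₂ g := by
  rw [← sub_eq_zero]
  refine (h₁.sub h₂).apply_eq_zero (V := (fun ξ : ℝ => exp (ξ * Complex.I)) ⁻¹'
    {w | ∀ᶠ v in 𝓝 w, H₁ v = H₂ v}) (isOpen_setOfPred_eventually_nhds.preimage (by fun_prop)) ?_ ?_
  · intro ξ hξ
    have hξ' : ∀ᶠ v in 𝓝 (exp (ξ * Complex.I)), H₁ v = H₂ v := hξ
    exact sub_eq_zero.2 hξ'.self_of_nhds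
  · exact fun ξ hξ => eventually_nhdsSet_iff_forall.1 hH _ (hg hξ)

theorem HasSymbol.eq_of_forall {T₁ T₂ : BUC X →L[ℂ] BUC X} {h : ℝ → ℂ}
    (h₁ : HasSymbol T₁ h) (h₂ : HasSymbol T₂ h) (g : BUC X) : T₁ g = T₂ g := by
  rw [← sub_eq_zero]
  exact (h₁.sub h₂).apply_eq_zero isOpen_univ (fun ξ _ => sub_self _) (subset_univ (sp g))

theorem isOpen_setOf_isUnit_one_add_smul {E : Type*} [NormedAddCommGroup E] [NormedSpace ℂ E]
    [CompleteSpace E] (R : E →L[ℂ] E) (z₀ : ℂ) : IsOpen {z : ℂ | IsUnit (1 + (z - z₀) • R)} :=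
  Units.isOpen.preimage (by fun_prop : Continuous fun z : ℂ => 1 + (z - z₀) • R)

theorem analyticOnNhd_inverse_one_add_smul {E : Type*} [NormedAddCommGroup E] [NormedSpace ℂ E]
    [CompleteSpace E] (R : E →L[ℂ] E) (z₀ : ℂ) :
    AnalyticOnNhd ℂ (fun z : ℂ => Ring.inverse (1 + (z - z₀) • R))
      {z : ℂ | IsUnit (1 + (z - z₀) • R)} := by
  rintro z ⟨v, hv⟩
  have h1 : AnalyticAt ℂ (fun z : ℂ => 1 + (z - z₀) • R) z :=
    analyticAt_const.add ((analyticAt_id.sub analyticAt_const).smul analyticAt_const)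
  have h2 : AnalyticAt ℂ (Ring.inverse : (E →L[ℂ] E) → _) (1 + (z - z₀) • R) :=
    hv ▸ analyticAt_inverse v
  exact h2.comp (f := fun z : ℂ => 1 + (z - z₀) • R) h1

/-- If the symbol of `T` vanishes near `e^{iξ}` then `ξ` is not in the spectrum of `T g`. -/
theorem HasSymbol.notMem_sp {T : BUC X →L[ℂ] BUC X} {H : ℂ → ℂ}
    (hT : HasSymbol T fun ξ => H (exp (ξ * Complex.I))) {ξ : ℝ}
    (hH : ∀ᶠ w in 𝓝 (exp (ξ * Complex.I)), H w = 0) (g : BUC X) : ξ ∉ sp (T g) := by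
  set z₀ : ℂ := ξ * Complex.I with hz₀
  -- Off the set `t` the function `H` vanishes, so `(e^{z₀} - w) ψ(w) H(w) = H(w)` everywhere: `Ψ`
  -- inverts `e^{z₀} - S(1)` on the range of `T`. As `(z₀ - 𝒟) N = e^{z₀} - S(1)`, the operator `N
  -- Ψ` acts there as `(z₀ - 𝒟)⁻¹`.
  obtain ⟨ψ, hψ, hψ1⟩ := exists_smooth_inverse (z := exp z₀) (t := {w | ∀ᶠ v in 𝓝 w, H v = 0}ᶜ)
    isOpen_setOfPred_eventually_nhds.isClosed_compl (by simpa using hH)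
  obtain ⟨Ψ, hΨ⟩ := exists_hasSymbol (X := X) hψ
  set N : BUC X →L[ℂ] BUC X := BUC.conv (unitKernel z₀) (integrable_unitKernel z₀)
  set R : BUC X →L[ℂ] BUC X := N.comp Ψ with hR
  have hRa : IsAutonomous R := (BUC.isAutonomous_conv _).comp hΨ.isAutonomous
  have key : ∀ x, IsDerivResolvent z₀ (T x) (R (T x)) := by
    intro x
    have h1 := isDerivResolvent_unitKernel z₀ (Ψ (T x))
    have h2 : HasSymbol ((exp z₀ • Ψ.comp T) - (BUC.S 1).comp (Ψ.comp T))
        fun ξ => H (exp (ξ * Complex.I)) := by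
      convert! ((hΨ.comp hT).smul (exp z₀)).sub ((hasSymbol_S 1).comp (hΨ.comp hT)) using 1
      ext1 η
      set w := exp (η * Complex.I)
      rw [Complex.ofReal_one, one_mul, ← sub_mul, ← mul_assoc]
      by_cases hw : ∀ᶠ v in 𝓝 w, H v = 0
      · rw [hw.self_of_nhds, mul_zero]
      · rw [(eventually_nhdsSet_iff_forall.1 hψ1 w hw).self_of_nhds, one_mul]
    have h3 := h2.eq_of_forall hT x
    have h4 : exp z₀ • Ψ (T x) - BUC.S 1 (Ψ (T x)) = T x := h3
    rw [h4] at h1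
    exact h1
  -- The resolvent identity continues `R` from `z₀` to nearby `z` as `R (1 + (z - z₀) R)⁻¹`.
  refine fun hmem => hmem ⟨_, fun z => R (T (Ring.inverse (1 + (z - z₀) • R) g)),
    isOpen_setOf_isUnit_one_add_smul R z₀, ?_, fun z hz => ?_, fun z hz _ => ?_⟩
  · simp [← hz₀]
  · have h1 := analyticOnNhd_inverse_one_add_smul R z₀ z hz
    exact ((R.comp T).comp (ContinuousLinearMap.apply ℂ (BUC X) g)).analyticAt _ |>.comp h1
  · set x := Ring.inverse (1 + (z - z₀) • R) g with hx
    have hg : x + (z - z₀) • R x = g := by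
      have := congrArg (fun C : BUC X →L[ℂ] BUC X => C g) (Ring.mul_inverse_cancel _ hz)
      exact this
    have h1 := isDerivResolvent_iff.1 (key x)
    rw [isDerivResolvent_iff]
    intro t
    convert! h1 t using 1
    have h2 : T g = T x + (z - z₀) • R (T x) := by
      rw [← hg, map_add, map_smul, hT.map_comm hRa]
    rw [h2]
    simp only [BUC.sub_fun, BUC.add_fun, BUC.smul_fun]
    module

end Smooth

/-! ### Mild solutions -/

section Mild

theorem Submodule.integral_mem_of_isClosed {E : Type*} [NormedAddCommGroup E] [NormedSpace ℂ E]
    [CompleteSpace E] {M : Submodule ℂ E} (hM : IsClosed (M : Set E)) {φ : ℝ → E}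
    (hφ : Integrable φ) (h : ∀ s, φ s ∈ M) : ∫ s, φ s ∈ M := by
  have := hM
  have e : M.mkQL (∫ s, φ s) = 0 := by
    rw [← ContinuousLinearMap.integral_comp_comm _ hφ]
    have : ∀ s, M.mkQL (φ s) = 0 := fun s => (Submodule.Quotient.mk_eq_zero M).2 (h s)
    simp [this]
  exact (Submodule.Quotient.mk_eq_zero M).1 e

theorem Submodule.hasDerivAt_mem {E : Type*} [NormedAddCommGroup E] [NormedSpace ℂ E]
    {M : Submodule ℂ E} (hM : IsClosed (M : Set E)) {φ : ℝ → E} {y : E} {t : ℝ}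
    (hφ : HasDerivAt φ y t) (h : ∀ s, φ s ∈ M) : y ∈ M := by
  refine hM.mem_of_tendsto (hasDerivAt_iff_tendsto_slope.1 hφ) (.of_forall fun s => ?_)
  rw [slope_def_module]
  have : (s - t)⁻¹ • (φ s - φ t) = ((s - t)⁻¹ : ℂ) • (φ s - φ t) := by
    rw [← Complex.ofReal_sub, ← Complex.ofReal_inv, Complex.coe_smul]
  rw [this]
  exact M.smul_mem _ (M.sub_mem (h s) (h t))

variable {X : Type*} [NormedAddCommGroup X] [NormedSpace ℂ X]

namespace BUC

theorem intervalIntegrable (g : BUC X) (a b : ℝ) :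
    IntervalIntegrable (fun s => g s) volume a b := (continuous_fun g).intervalIntegrable a b

/-- `g ↦ ∫_0^t g(s) ds`. -/
def primitive (t : ℝ) : BUC X →L[ℂ] X :=
  LinearMap.mkContinuous
    { toFun := fun g => ∫ s in (0 : ℝ)..t, g s
      map_add' := fun g h =>
        intervalIntegral.integral_add (intervalIntegrable g 0 t) (intervalIntegrable h 0 t)
      map_smul' := fun c g => intervalIntegral.integral_smul c _ }
    |t - 0| (fun g => by
      rw [mul_comm]
      exact intervalIntegral.norm_integral_le_of_norm_le_const fun s _ => norm_fun_le g s)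

theorem primitive_apply (t : ℝ) (g : BUC X) : primitive t g = ∫ s in (0 : ℝ)..t, g s := rfl

theorem primitive_S (t s : ℝ) (g : BUC X) :
    primitive t (S s g) = primitive (t + s) g - primitive s g := by
  rw [primitive_apply, primitive_apply, primitive_apply,
    intervalIntegral.integral_interval_sub_left (intervalIntegrable g _ _)
      (intervalIntegrable g _ _)]
  simp only [S_fun]
  rw [intervalIntegral.integral_comp_add_right (fun r => g r), zero_add]

theorem hasDerivAt_primitive [CompleteSpace X] (g : BUC X) (t : ℝ) :
    HasDerivAt (fun t => primitive t g) (g t) t :=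
  intervalIntegral.integral_hasDerivAt_right (intervalIntegrable g 0 t)
    ((continuous_fun g).stronglyMeasurableAtFilter _ _) (continuous_fun g).continuousAt

end BUC

/-- The pair `(∫_0^t u, u(t) - u(0) - ∫_0^t (ℬu + f))`. -/
def mildPair (B : BUC X →L[ℂ] BUC X) (t : ℝ) : BUC X × BUC X →L[ℂ] X × X :=
  ((BUC.primitive t).comp (ContinuousLinearMap.fst ℂ _ _)).prod
    ((BUC.evalCLM t - BUC.evalCLM 0 : BUC X →L[ℂ] X).comp (ContinuousLinearMap.fst ℂ _ _) -
      (BUC.primitive t).comp (B.comp (ContinuousLinearMap.fst ℂ _ _) +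
        ContinuousLinearMap.snd ℂ _ _))

/-- The space of all `(u, f)` such that `u` is a mild solution for the inhomogeneity `f`. -/
def mildSubmodule (A : X →ₗ.[ℂ] X) (B : BUC X →L[ℂ] BUC X) : Submodule ℂ (BUC X × BUC X) :=
  ⨅ t : ℝ, A.graph.comap (mildPair B t : BUC X × BUC X →ₗ[ℂ] X × X)

variable {A : X →ₗ.[ℂ] X} {B : BUC X →L[ℂ] BUC X}

theorem mem_mildSubmodule_iff {p : BUC X × BUC X} :
    p ∈ mildSubmodule A B ↔ ∀ t, mildPair B t p ∈ A.graph := by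
  simp [mildSubmodule, Submodule.mem_iInf]

theorem mildPair_apply (t : ℝ) (u f : BUC X) :
    mildPair B t (u, f) = (BUC.primitive t u, u t - u 0 - BUC.primitive t (B u + f)) := rfl

theorem isMildSolution_iff {u f : BUC X} :
    IsMildSolution A B f u ↔ (u, f) ∈ mildSubmodule A B := by
  rw [mem_mildSubmodule_iff]
  refine forall_congr' fun t => ?_
  rw [mildPair_apply, LinearPMap.mem_graph_iff]
  constructor
  · rintro ⟨h, e⟩
    refine ⟨⟨_, h⟩, rfl, ?_⟩
    rw [e]
    exact (add_sub_cancel_right _ _).symm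
  · rintro ⟨⟨y, hy⟩, rfl, e⟩
    exact ⟨hy, (sub_eq_iff_eq_add.1 e.symm)⟩

theorem isClosed_mildSubmodule (hA : A.IsClosed) :
    IsClosed (mildSubmodule A B : Set (BUC X × BUC X)) := by
  have : (mildSubmodule A B : Set (BUC X × BUC X)) =
      ⋂ t : ℝ, mildPair B t ⁻¹' (A.graph : Set (X × X)) := by
    ext p; simp [mem_mildSubmodule_iff]
  rw [this]
  exact isClosed_iInter fun t => IsClosed.preimage (mildPair B t).continuous hA

/-- The `mildPair` at `t` of the translated pair is the difference of the original ones at `t + s`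
and at `s`, and the graph of `A` is a subspace. -/
theorem S_mem_mildSubmodule (hB : IsAutonomous B) {u f : BUC X} (h : (u, f) ∈ mildSubmodule A B)
    (s : ℝ) : (BUC.S s u, BUC.S s f) ∈ mildSubmodule A B := by
  rw [mem_mildSubmodule_iff] at h ⊢
  intro t
  convert! A.graph.sub_mem (h (t + s)) (h s) using 1
  simp only [mildPair_apply, hB s u, ← map_add, BUC.primitive_S, Prod.mk_sub_mk, BUC.S_fun,
    zero_add]
  congr 1
  abel

theorem HasSymbol.mem_mildSubmodule (hA : A.IsClosed) (hB : IsAutonomous B)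
    {T : BUC X →L[ℂ] BUC X} {h : ℝ → ℂ} (hT : HasSymbol T h) {u f : BUC X}
    (hu : (u, f) ∈ mildSubmodule A B) : (T u, T f) ∈ mildSubmodule A B := by
  obtain ⟨J, hJ, c, s, hc, h1, h2⟩ := hT
  refine (isClosed_mildSubmodule hA).mem_of_tendsto ((h1 u).prodMk (h1 f)) (.of_forall fun F => ?_)
  exact Submodule.sum_mem _ fun j _ => Submodule.smul_mem _ (c j) (S_mem_mildSubmodule hB hu (s j))

variable [CompleteSpace X]

theorem conv_mem_mildSubmodule (hA : A.IsClosed) (hB : IsAutonomous B) {k : ℝ → ℂ}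
    (hk : Integrable k) {u f : BUC X} (hu : (u, f) ∈ mildSubmodule A B) :
    (BUC.conv k hk u, BUC.conv k hk f) ∈ mildSubmodule A B := by
  have hi := (BUC.integrable_smul_S hk u).prodMk (BUC.integrable_smul_S hk f)
  have := Submodule.integral_mem_of_isClosed (isClosed_mildSubmodule hA) hi fun s =>
    Submodule.smul_mem _ (k s) (S_mem_mildSubmodule hB hu s)
  rwa [integral_pair (BUC.integrable_smul_S hk u) (BUC.integrable_smul_S hk f)] at this

/-- If `u` is a mild solution then `(z - 𝒜 - ℬ) (z - 𝒟)⁻¹ u = u + (z - 𝒟)⁻¹ f`. -/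
theorem sumOp_of_isDerivResolvent (hA : A.IsClosed) (hB : IsAutonomous B) {u f x y : BUC X}
    (hu : IsMildSolution A B f u) {z : ℂ} (hz : z.re ≠ 0) (hx : IsDerivResolvent z u x)
    (hy : IsDerivResolvent z f y) :
    ∃ h : x ∈ (sumOp A B).domain, sumOp A B ⟨x, h⟩ = z • x - u - y := by
  have hmem : (x, y) ∈ mildSubmodule A B := by
    rw [hx.eq_conv hz, hy.eq_conv hz]
    exact conv_mem_mildSubmodule hA hB _ (isMildSolution_iff.1 hu)
  rw [mem_mildSubmodule_iff] at hmem
  -- The integrated equation for `(x, y)` is differentiated in `t`, with `x' = z x - u`; the closed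
  -- graph contains the derivative.
  have hgraph : ∀ t, (x t, (z • x - u - (B x + y)) t) ∈ A.graph := by
    intro t
    refine Submodule.hasDerivAt_mem hA (t := t) ?_ hmem
    simp only [mildPair_apply]
    exact (BUC.hasDerivAt_primitive x t).prodMk
      (((isDerivResolvent_iff.1 hx t).sub_const (x 0)).sub
        (BUC.hasDerivAt_primitive (B x + y) t))
  have hdom : ∀ t, ∃ ht : x t ∈ A.domain, A ⟨x t, ht⟩ = (z • x - u - (B x + y)) t := by
    intro t
    obtain ⟨⟨v, hv⟩, e1, e2⟩ := (LinearPMap.mem_graph_iff A).1 (hgraph t)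
    cases e1
    exact ⟨hv, e2⟩
  have h : x ∈ (multOp A).domain := ⟨_, hdom⟩
  refine ⟨h, BUC.ext_fun fun t => ?_⟩
  obtain ⟨ht, e⟩ := multOp_apply A ⟨x, h⟩ t
  obtain ⟨ht', e'⟩ := hdom t
  have e3 : (multOp A ⟨x, h⟩) t = (z • x - u - (B x + y)) t := e.symm.trans e'
  change (B x) t + (multOp A ⟨x, h⟩) t = _
  rw [e3]
  simp only [BUC.sub_fun, BUC.add_fun, BUC.smul_fun]
  abel

/-- The spectrum of a mild solution. -/
theorem IsMildSolution.sp_subset (hA : A.IsClosed) (hB : IsAutonomous B) {u f : BUC X}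
    (hu : IsMildSolution A B f u) : sp u ⊆ imagSpectrum (sumOp A B) ∪ sp f := by
  intro ξ hξ
  by_contra hcon
  rw [mem_union, not_or] at hcon
  obtain ⟨h1, h2⟩ := hcon
  obtain ⟨U, F, hU, hm, hF, hr⟩ := not_not.1 h2
  obtain ⟨R, -, hR⟩ := not_not.1 h1
  set z₀ : ℂ := ξ * Complex.I
  -- With `R = (z₀ - 𝒜 - ℬ)⁻¹` and `x = (z - 𝒟)⁻¹u`, the equation `(z₀ - 𝒜 - ℬ) x = u + F z - (z -
  -- z₀) x` becomes `(1 + (z - z₀) R) x = R (u + F z)`. Its solution is analytic up to `z₀`.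
  refine hξ ⟨U ∩ {z | IsUnit (1 + (z - z₀) • R)},
    fun z => Ring.inverse (1 + (z - z₀) • R) (R (u + F z)),
    hU.inter (isOpen_setOf_isUnit_one_add_smul R z₀), ⟨hm, by simp [z₀]⟩, fun z hz => ?_,
    fun z hz hz0 => ?_⟩
  · have h3 := analyticOnNhd_inverse_one_add_smul R z₀ z hz.2
    have h4 : AnalyticAt ℂ (fun z => R (u + F z)) z :=
      (R.analyticAt _).comp (f := fun z => u + F z) (analyticAt_const.add (hF z hz.1))
    exact ((ContinuousLinearMap.id ℂ (BUC X →L[ℂ] BUC X)).analyticAt_bilinear (_, _)).comp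
      (f := fun z => (Ring.inverse (1 + (z - z₀) • R), R (u + F z))) (h3.prod h4)
  · set x := BUC.conv (resolventKernel z) (integrable_resolventKernel hz0) u
    have hx : IsDerivResolvent z u x := isDerivResolvent_conv hz0 u
    obtain ⟨hd, e⟩ := sumOp_of_isDerivResolvent hA hB hu hz0 hx (hr z hz.1 hz0)
    have e1 := hR ⟨x, hd⟩
    rw [e] at e1
    have e2 : z₀ • x - (z • x - u - F z) = (u + F z) - (z - z₀) • x := by
      rw [BUC.sub_smul]; abel
    have e3 : R (u + F z) = (1 + (z - z₀) • R) x := by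
      change R (u + F z) = x + (z - z₀) • R x
      have e4 : R (z₀ • x - (z • x - u - F z)) = x := e1
      rw [e2, map_sub, map_smul] at e4
      rw [← sub_eq_iff_eq_add]
      exact e4
    have e5 : Ring.inverse (1 + (z - z₀) • R) (R (u + F z)) = x := by
      rw [e3]
      exact congrArg (fun C : BUC X →L[ℂ] BUC X => C x) (Ring.inverse_mul_cancel _ hz.2)
    simp only [e5]
    exact hx

end Mild

/-! ### The Riesz projection -/

section Riesz

open Complex (exp)

variable {X : Type*} [NormedAddCommGroup X] [NormedSpace ℂ X]

/-- The restriction of an autonomous operator to a spectral subspace. -/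
def restrictSpectral (L : Set ℝ) (T : BUC X →L[ℂ] BUC X) (hT : IsAutonomous T) :
    spectralSubspace X L →L[ℂ] spectralSubspace X L :=
  (T.comp (spectralSubspace X L).subtypeL).codRestrict (spectralSubspace X L)
    (fun g => hT.mem_spectralSubspace g.2)

variable [CompleteSpace X]

/-- If the symbol of `T` vanishes near `M'`, then the translation operator has its spectrum in
`M` on the range of `T` in the spectral subspace of `M' ∪ M`. -/
theorem HasSymbol.spectrumOnRangeSubset {T : BUC X →L[ℂ] BUC X} {Φ : ℂ → ℂ}
    (hT : HasSymbol T fun ξ => Φ (exp (ξ * Complex.I))) {M M' : Set ℂ} (hM : IsClosed M)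
    (hΦ : ∀ᶠ w in 𝓝ˢ M', Φ w = 0) :
    SpectrumOnRangeSubset (E := spectralSubspace X (expPreimage (M' ∪ M)))
      (restrictedS X (expPreimage (M' ∪ M)) 1) (restrictSpectral _ T hT.isAutonomous) M := by
  intro z hz
  obtain ⟨ψ, hψ, hψ1⟩ := exists_smooth_inverse hM hz
  obtain ⟨Ψ, hΨ⟩ := exists_hasSymbol (X := X) hψ
  refine ⟨restrictSpectral _ Ψ hΨ.isAutonomous, fun x hx => ?_⟩
  have hTx : T (x : BUC X) = x := congrArg Subtype.val hx
  have key : z • Ψ (x : BUC X) - BUC.S 1 (Ψ (x : BUC X)) = x := by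
    -- This symbol agrees with `Φ` near `M' ∪ M`: near `M'` both vanish, and near `M` one has `(z -
    -- w) ψ = 1`. Locality turns this into an identity of operators on the spectral subspace.
    have h1 : HasSymbol ((z • Ψ.comp T) - (BUC.S 1).comp (Ψ.comp T)) fun ξ =>
        (fun w => (z - w) * ψ w * Φ w) (exp (ξ * Complex.I)) := by
      convert! ((hΨ.comp hT).smul z).sub ((hasSymbol_S 1).comp (hΨ.comp hT)) using 1
      ext1 η
      rw [Complex.ofReal_one, one_mul]
      ring
    have h2 := h1.apply_eq_apply (H₁ := fun w => (z - w) * ψ w * Φ w) hT (K := M' ∪ M) (g := x) (by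
      rw [nhdsSet_union]
      refine eventually_sup.2 ⟨?_, ?_⟩
      · filter_upwards [hΦ] with w hw using by rw [hw, mul_zero]
      · filter_upwards [hψ1] with w hw using by rw [hw, one_mul]) x.2
    have h3 : z • Ψ (T (x : BUC X)) - BUC.S 1 (Ψ (T (x : BUC X))) = T x := h2
    rwa [hTx] at h3
  refine ⟨Subtype.ext ?_, Subtype.ext key, Subtype.ext ?_⟩
  · change T (Ψ (x : BUC X)) = Ψ (x : BUC X)
    rw [hΨ.map_comm hT.isAutonomous, hTx]
  · change Ψ (z • (x : BUC X) - BUC.S 1 (x : BUC X)) = x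
    rw [map_sub, map_smul, hΨ.isAutonomous]
    exact key

/-- `Φ² = Φ` near `M₁ ∪ M₂`, so `T` is idempotent on the spectral subspace. The complementary
projection has symbol `1 - Φ`, for which `M₁` and `M₂` exchange roles. -/
theorem HasSymbol.isRieszProjection {T : BUC X →L[ℂ] BUC X} {Φ : ℂ → ℂ}
    (hT : HasSymbol T fun ξ => Φ (exp (ξ * Complex.I))) {M₁ M₂ : Set ℂ} (hM₁ : IsClosed M₁)
    (hM₂ : IsClosed M₂) (h0 : ∀ᶠ w in 𝓝ˢ M₁, Φ w = 0) (h1 : ∀ᶠ w in 𝓝ˢ M₂, Φ w = 1) :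
    IsRieszProjection (E := spectralSubspace X (expPreimage (M₁ ∪ M₂)))
      (restrictedS X (expPreimage (M₁ ∪ M₂)) 1) M₁ M₂
      (restrictSpectral _ T hT.isAutonomous) where
  idem x := Subtype.ext <| by
    refine (hT.comp hT).apply_eq_apply (H₁ := fun w => Φ w * Φ w) hT (K := M₁ ∪ M₂) ?_ x.2
    rw [nhdsSet_union]
    refine eventually_sup.2 ⟨?_, ?_⟩
    · filter_upwards [h0] with w hw using by rw [hw, mul_zero]
    · filter_upwards [h1] with w hw using by rw [hw, mul_one]
  comm x := Subtype.ext (hT.isAutonomous 1 x)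
  range_spec := hT.spectrumOnRangeSubset hM₂ h0
  ker_spec := by
    have h2 : HasSymbol (ContinuousLinearMap.id ℂ (BUC X) - T) fun ξ =>
        (fun w => 1 - Φ w) (exp (ξ * Complex.I)) := hasSymbol_id.sub hT
    have h3 := HasSymbol.spectrumOnRangeSubset (Φ := fun w => 1 - Φ w) h2 hM₁ (M' := M₂) (by
      filter_upwards [h1] with w hw using by rw [hw, sub_self])
    rw [union_comm] at h3
    exact h3

end Riesz

end

/-! ### The spectral separation theorem -/

theorem theorem20 {X : Type*} [NormedAddCommGroup X] [NormedSpace ℂ X] [CompleteSpace X]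
    (A : X →ₗ.[ℂ] X) (hA : A.IsClosed)
    (B : BUC X →L[ℂ] BUC X) (hB : IsAutonomous B)
    (f : BUC X) (hf : IsAlmostPeriodic f)
    (Sig₁ Sig₂ : Set ℂ)
    (hSig₁ : Sig₁ = closure (expSet (imagSpectrum (sumOp A B)) \ expSet (sp f)))
    (hSig₂ : Sig₂ = closure (expSet (sp f)))
    (hdisj : Disjoint Sig₁ Sig₂)
    (L : Set ℝ) (hL : L = expPreimage (Sig₁ ∪ Sig₂))
    (u : BUC X) (hu : IsMildSolution A B f u) :
    ∃ w : BUC X, IsMildSolution A B f w ∧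
      expSet (sp w) ⊆ closure (expSet (sp f)) ∧
      ∃ (huL : u ∈ spectralSubspace X L)
        (Q : spectralSubspace X L →L[ℂ] spectralSubspace X L),
        IsRieszProjection (E := spectralSubspace X L) (restrictedS X L 1) Sig₁ Sig₂ Q ∧
        w = (Q ⟨u, huL⟩ : BUC X) := by
  subst hSig₁ hSig₂ hL
  set Sig₁ := closure (expSet (imagSpectrum (sumOp A B)) \ expSet (sp f))
  set Sig₂ := closure (expSet (sp f))
  obtain ⟨φ, hφ, h0, h1⟩ := exists_smooth_zero_one (s := Sig₁) (t := Sig₂) isClosed_closure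
    isClosed_closure hdisj
  obtain ⟨T, hT⟩ := exists_hasSymbol (X := X) hφ
  have huL : u ∈ spectralSubspace X (expPreimage (Sig₁ ∪ Sig₂)) := by
    intro ξ hξ
    -- The case split is on `e^{iξ}` rather than on `ξ`, because `Sig₁` removes the image `e^{i
    -- sp(f)}` and not `sp f` itself.
    by_cases hξf : Complex.exp (ξ * Complex.I) ∈ expSet (sp f)
    · exact Or.inr (subset_closure hξf)
    · refine Or.inl (subset_closure ⟨?_, hξf⟩)
      rcases hu.sp_subset hA hB hξ with h | h
      · exact mem_image_of_mem _ h
      · exact absurd (mem_image_of_mem _ h) hξf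
  have hTf : T f = f := by
    refine hT.apply_eq_apply (H₂ := fun _ => 1) hasSymbol_id (K := Sig₂) h1 fun ξ hξ => ?_
    exact subset_closure (mem_image_of_mem _ hξ)
  refine ⟨T u, ?_, ?_, huL, restrictSpectral _ T hT.isAutonomous,
    hT.isRieszProjection isClosed_closure isClosed_closure h0 h1, rfl⟩
  · have := hT.mem_mildSubmodule hA hB (isMildSolution_iff.1 hu)
    rw [hTf] at this
    exact isMildSolution_iff.2 this
  · rintro _ ⟨ξ, hξ, rfl⟩
    -- `sp (T u) ⊆ sp u` leaves only `Sig₁` and `Sig₂`; the first is excluded since `φ` vanishes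
    -- near it.
    rcases huL (hT.isAutonomous.sp_subset u hξ) with h | h
    · exact absurd hξ (hT.notMem_sp (eventually_nhdsSet_iff_forall.1 h0 _ h) u)
    · exact h
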